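/- Let $\lambda$ be a limit ordinal. Let $\mathcal{E}_\lambda$ be the set of all nontrivial (that is, non-identity) elementary embeddings $j\colon (V_\lambda,\in)\to(V_\lambda,\in)$, each identified with its graph $\{\langle x,j(x)\rangle : x\in V_\lambda\}\subseteq V_\lambda$. For $j\in\mathcal{E}_\lambda$ let $\operatorname{crit} j$ be the least ordinal $\kappa$ with $\kappa<j(\kappa)$ and let $\operatorname{rng} j$ be the range of $j$. For $A\subseteq V_\lambda$ put $j\cdot A=\bigcup_{\alpha<\lambda}j(A\cap V_\alpha)$; for $k\in\mathcal{E}_\lambda$ this gives the application $jk=j\cdot k\in\mathcal{E}_\lambda$, and $j j_1\cdots j_n$ denotes $(\cdots((j j_1)j_2)\cdots)j_n$. For $A\subseteq V_\lambda$ let $\mathrm{Def}^{V_\lambda}(A)$ be the set of those $b\in V_\lambda$ for which there are a first-order formula $\varphi(x,y_1,\dots,y_m)$ in the language $\{\in\}$ and $a_1,\dots,a_m\in A$ such that $b$ is the unique element of $V_\lambda$ with $V_\lambda\models\varphi[b,a_1,\dots,a_m]$. Suppose that $j\in\mathcal{E}_\lambda$, that $\delta$ and $\mu$ are cardinals with $\operatorname{crit}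 j<\delta<\mu<\lambda$, and that $$\mathrm{Def}^{V_\lambda}(\operatorname{rng} j\cup V_\delta)\cap[\delta,\mu)=\emptyset.$$ Then for every $n\ge 0$ and all $j_1,\dots,j_n\in\mathcal{E}_\lambda$ such that $\operatorname{crit}(j j_1\cdots j_i)<\delta$ for all $i\le n$, the embedding $k=j j_1\cdots j_n$ satisfies $$\operatorname{rng} k\cap[\delta,\mu)=\emptyset.$$ -/

import Mathlib

universe u

namespace RankToRank

open FirstOrder ZFSet

/-- The relation symbols of the language of set theory: one binary symbol. -/
inductive MemRel : ℕ → Type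
  | mem : MemRel 2

/-- The language of set theory `{∈}`. -/
def setLang : Language := ⟨fun _ => Empty, MemRel⟩

/-- The elements of the rank-initial segment `V_lam` of the universe of sets. -/
abbrev Rank (lam : Ordinal.{u}) : Type (u + 1) := {x : ZFSet.{u} // x ∈ V_ lam}

/-- `V_lam` as a structure for the language of set theory, with the true membership relation. -/
instance rankStructure (lam : Ordinal.{u}) : setLang.Structure (Rank lam) where
  funMap f := nomatch f
  RelMap | .mem => fun x => (x 0).1 ∈ (x 1).1

/-- The graph of a function `V_lam → V_lam`, the set of all ordered pairs `⟨x, e x⟩`. -/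
noncomputable def graph {lam : Ordinal.{u}} (e : Rank lam → Rank lam) : ZFSet.{u} :=
  ZFSet.range fun x : Rank lam => pair x.1 (e x).1

/-- `𝓔_lam`: the set of nontrivial elementary embeddings `V_lam → V_lam`, each of them encoded
as its graph, which is a subset of `V_lam` when `lam` is a limit ordinal. -/
def Emb (lam : Ordinal.{u}) : Set ZFSet.{u} :=
  {f | ∃ e : Rank lam ↪ₑ[setLang] Rank lam, (∃ x, e x ≠ x) ∧ f = graph e}

/-- The value `f(x)` of a function `f` (a set of ordered pairs) at `x`:
the unique `y` with `⟨x, y⟩ ∈ f` if `x` is in the domain of `f`, and `∅` if it is not. -/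
noncomputable def val (f x : ZFSet.{u}) : ZFSet.{u} :=
  ⋃₀ ((⋃₀ (⋃₀ f : ZFSet.{u}) : ZFSet.{u}).sep fun y => pair x y ∈ f)

/-- The range of a function. -/
def rng (f : ZFSet.{u}) : Set ZFSet.{u} :=
  {y | ∃ x, pair x y ∈ f}

/-- The critical point: the least ordinal `κ` with `κ < f(κ)`. -/
noncomputable def crit (f : ZFSet.{u}) : Ordinal.{u} :=
  sInf {κ | κ.toZFSet ∈ val f κ.toZFSet}

/-- The application `j · A = ⋃_{α < lam} j(A ∩ V_α)` of `j : V_lam → V_lam` to `A ⊆ V_lam`.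
When `A` is (the graph of) an embedding `k`, this is (the graph of) the embedding `j k`. -/
noncomputable def app (lam : Ordinal.{u}) (j A : ZFSet.{u}) : ZFSet.{u} :=
  ZFSet.iUnion fun α : Set.Iio lam => val j (A ∩ V_ α.1)

/-- The left-parenthesized product `((j · js 0) · js 1) ⋯ js (n - 1)` of `j` and the
first `n` terms of `js`. -/
noncomputable def leftProd (lam : Ordinal.{u}) (j : ZFSet.{u}) (js : ℕ → ZFSet.{u}) : ℕ → ZFSet.{u}
  | 0 => j
  | n + 1 => app lam (leftProd lam j js n) (js n)

/-- `Def^{V_lam}(A)`: the elements of `V_lam` that are definable in the structure `V_lam` by a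
first-order formula with parameters from `A`. -/
def DefIn (lam : Ordinal.{u}) (A : Set ZFSet.{u}) : Set ZFSet.{u} :=
  {b | ∃ hb : b ∈ V_ lam,
    Set.Definable₁ {x : Rank lam | x.1 ∈ A} setLang {(⟨b, hb⟩ : Rank lam)}}

/-- The set of ordinals `[δ, μ)`, as von Neumann ordinals. -/
def interval (δ μ : Ordinal.{u}) : Set ZFSet.{u} :=
  Ordinal.toZFSet '' Set.Ico δ μ

end RankToRank

/-!
We show by induction on `n` that even `Def(rng k ∪ V_δ)` misses `[δ, μ)`. For the inductive step let
`e` be an embedding with this property and let `g = e f` have its critical point below `δ`. We may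
assume that `δ` is a limit, since otherwise it is definable from elements of `V_δ`. By Kunen's
theorem the iterates of the critical point of `g` have no supremum below `lam`, so some `a < δ` has
`δ ≤ g(a)`. The pieces `e(f ∩ V_c)` of the graph of `g` lie in `rng e`, so `g(x)` is definable from
`rng e ∪ V_δ` whenever `x ∈ V_δ`; in particular `g(a)` is, hence `μ ≤ g(a)`. Now let `b ∈ [δ, μ)` be
defined by a formula from `g(x)` and `p ∈ V_δ`, and let `s ∈ V_δ` be the function that sends each
`p' ∈ V_a` to the element of `V_a` defined by the same formula from `x` and `p'`. Then `p` and `b`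
belong to `V_{g(a)}`, so `b = g(s)(p)` is definable from `rng e ∪ V_δ`, a contradiction.
-/

universe v

namespace RankToRank

open FirstOrder ZFSet Cardinal

variable {lam : Ordinal.{u}} {α β : Type}

theorem rank_lt (x : Rank lam) : x.1.rank < lam := mem_vonNeumann.1 x.2

theorem mem_rank_of_mem {x : ZFSet.{u}} {y : Rank lam} (h : x ∈ y.1) : x ∈ V_ lam :=
  (isTransitive_vonNeumann lam).mem_trans h y.2

theorem rank_ext {x y : Rank lam} (h : ∀ z : Rank lam, z.1 ∈ x.1 ↔ z.1 ∈ y.1) : x = y :=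
  Subtype.ext <| ZFSet.ext fun z =>
    ⟨fun hz => (h ⟨z, mem_rank_of_mem hz⟩).1 hz, fun hz => (h ⟨z, mem_rank_of_mem hz⟩).2 hz⟩

theorem pair_mem_vonNeumann {o : Ordinal.{u}} (ho : Order.IsSuccLimit o) {x y : ZFSet.{u}}
    (hx : x ∈ V_ o) (hy : y ∈ V_ o) : pair x y ∈ V_ o := by
  rw [mem_vonNeumann] at *
  rw [pair, rank_pair, rank_pair, rank_singleton]
  exact max_lt (ho.succ_lt (ho.succ_lt hx)) (ho.succ_lt (max_lt (ho.succ_lt hx) (ho.succ_lt hy)))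

theorem pair_mem_vonNeumann_succ_succ {a : Ordinal.{u}} {x y : ZFSet.{u}} (hx : x ∈ V_ a)
    (hy : y ∈ V_ a) : pair x y ∈ V_ (Order.succ (Order.succ a)) := by
  rw [mem_vonNeumann] at *
  rw [pair, rank_pair, rank_pair, rank_singleton]
  simp only [max_lt_iff, Order.succ_lt_succ_iff]
  exact ⟨hx, hx, hy⟩

theorem mem_rank_of_pair_mem {x y : ZFSet.{u}} {z : Rank lam} (h : pair x y ∈ z.1) :
    x ∈ V_ lam ∧ y ∈ V_ lam := by
  have hxy : ({x, y} : ZFSet) ∈ V_ lam :=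
    mem_rank_of_mem (y := ⟨pair x y, mem_rank_of_mem h⟩) (by simp [pair])
  exact ⟨mem_rank_of_mem (y := ⟨_, hxy⟩) (by simp), mem_rank_of_mem (y := ⟨_, hxy⟩) (by simp)⟩

/-- A predicate on tuples from `V_lam` that is the truth set of a parameter-free formula. -/
def Expressible (P : (α → Rank lam) → Prop) : Prop :=
  ∃ φ : setLang.Formula α, ∀ v, φ.Realize v ↔ P v

namespace Expressible

variable {P Q : (α → Rank lam) → Prop}

theorem map_iff (h : Expressible P) (e : Rank lam ↪ₑ[setLang] Rank lam) (v : α → Rank lam) :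
    P (fun i => e (v i)) ↔ P v := by
  obtain ⟨φ, hφ⟩ := h
  rw [← hφ, ← hφ]
  exact e.map_formula φ v

theorem congr (h : Expressible P) (hPQ : ∀ v, Q v ↔ P v) : Expressible Q := by
  obtain ⟨φ, hφ⟩ := h
  exact ⟨φ, fun v => (hφ v).trans (hPQ v).symm⟩

theorem mem (i j : α) : Expressible fun v : α → Rank lam => (v i).1 ∈ (v j).1 :=
  ⟨Language.Relations.formula₂ (show setLang.Relations 2 from MemRel.mem) (.var i) (.var j),
    fun _ => Language.Formula.realize_rel₂⟩

theorem eq (i j : α) : Expressible fun v : α → Rank lam => (v i).1 = (v j).1 :=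
  ⟨Language.Term.equal (.var i) (.var j), fun _ =>
    Language.Formula.realize_equal.trans Subtype.ext_iff⟩

theorem eq_rank (i j : α) : Expressible fun v : α → Rank lam => v i = v j :=
  (eq i j).congr fun _ => Subtype.ext_iff

theorem not (h : Expressible P) : Expressible fun v => ¬ P v := by
  obtain ⟨φ, hφ⟩ := h
  exact ⟨φ.not, fun v => by rw [Language.Formula.realize_not, hφ]⟩

theorem and (h : Expressible P) (h' : Expressible Q) : Expressible fun v => P v ∧ Q v := by
  obtain ⟨φ, hφ⟩ := h
  obtain ⟨ψ, hψ⟩ := h'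
  exact ⟨φ ⊓ ψ, fun v => by rw [Language.Formula.realize_inf, hφ, hψ]⟩

theorem or (h : Expressible P) (h' : Expressible Q) : Expressible fun v => P v ∨ Q v := by
  obtain ⟨φ, hφ⟩ := h
  obtain ⟨ψ, hψ⟩ := h'
  exact ⟨φ ⊔ ψ, fun v => by rw [Language.Formula.realize_sup, hφ, hψ]⟩

theorem imp (h : Expressible P) (h' : Expressible Q) : Expressible fun v => P v → Q v := by
  obtain ⟨φ, hφ⟩ := h
  obtain ⟨ψ, hψ⟩ := h'
  exact ⟨φ.imp ψ, fun v => by rw [Language.Formula.realize_imp, hφ, hψ]⟩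

theorem iff (h : Expressible P) (h' : Expressible Q) : Expressible fun v => P v ↔ Q v :=
  ((h.imp h').and (h'.imp h)).congr fun _ => iff_def

theorem comp (h : Expressible P) (σ : α → β) :
    Expressible fun v : β → Rank lam => P (fun i => v (σ i)) := by
  obtain ⟨φ, hφ⟩ := h
  exact ⟨φ.relabel σ, fun v => by rw [Language.Formula.realize_relabel, hφ]; rfl⟩

theorem forall_finite [Finite β] {R : β → (α → Rank lam) → Prop} (h : ∀ i, Expressible (R i)) :
    Expressible fun v => ∀ i, R i v := by
  choose φ hφ using h
  exact ⟨Language.Formula.iInf φ, fun v => by simp only [Language.Formula.realize_iInf, hφ]⟩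

theorem forall_tuple [Finite β] {R : (α → Rank lam) → (β → Rank lam) → Prop}
    (h : Expressible fun w : α ⊕ β → Rank lam => R (fun i => w (.inl i)) (fun i => w (.inr i))) :
    Expressible fun v => ∀ x, R v x := by
  obtain ⟨φ, hφ⟩ := h
  refine ⟨φ.iAlls β, fun v => ?_⟩
  rw [Language.Formula.realize_iAlls]
  exact forall_congr' fun x => hφ _

theorem exists_tuple [Finite β] {R : (α → Rank lam) → (β → Rank lam) → Prop}
    (h : Expressible fun w : α ⊕ β → Rank lam => R (fun i => w (.inl i)) (fun i => w (.inr i))) :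
    Expressible fun v => ∃ x, R v x :=
  (forall_tuple (R := fun v x => ¬ R v x) h.not).not.congr fun _ => by push Not; rfl

section Quantifiers

variable {R : (α → Rank lam) → Rank lam → Prop} {S : (α → Rank lam) → ZFSet.{u} → Prop}

theorem all
    (h : Expressible fun w : α ⊕ Unit → Rank lam => R (fun i => w (.inl i)) (w (.inr ()))) :
    Expressible fun v => ∀ x, R v x :=
  (forall_tuple (β := Unit) (R := fun v x => R v (x ())) h).congr fun _ =>
    ⟨fun H x => H (x ()), fun H x => H fun _ => x⟩

theorem ex
    (h : Expressible fun w : α ⊕ Unit → Rank lam => R (fun i => w (.inl i)) (w (.inr ()))) :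
    Expressible fun v => ∃ x, R v x :=
  (all (R := fun v x => ¬ R v x) h.not).not.congr fun _ => by push Not; rfl

theorem ball (i : α)
    (h : Expressible fun w : α ⊕ Unit → Rank lam => S (fun i => w (.inl i)) (w (.inr ())).1) :
    Expressible fun v => ∀ x ∈ (v i).1, S v x :=
  (all (R := fun v x => x.1 ∈ (v i).1 → S v x.1) ((mem _ _).imp h)).congr fun _ =>
    ⟨fun H x hx => H x.1 hx, fun H x hx => H ⟨x, mem_rank_of_mem hx⟩ hx⟩

theorem bex (i : α)
    (h : Expressible fun w : α ⊕ Unit → Rank lam => S (fun i => w (.inl i)) (w (.inr ())).1) :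
    Expressible fun v => ∃ x ∈ (v i).1, S v x :=
  (ball (S := fun v x => ¬ S v x) i h.not).not.congr fun _ => by push Not; rfl

theorem eq_of_subset {s : (α → Rank lam) → ZFSet.{u}} (i : α) (hs : ∀ v, s v ⊆ V_ lam)
    (h : Expressible fun w : α ⊕ Unit → Rank lam => (w (.inr ())).1 ∈ s fun i => w (.inl i)) :
    Expressible fun v => (v i).1 = s v :=
  (all (R := fun v x => x.1 ∈ (v i).1 ↔ x.1 ∈ s v) ((mem _ _).iff h)).congr fun v =>
    ⟨fun H x => by rw [H], fun H => ZFSet.ext fun x =>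
      ⟨fun hx => (H ⟨x, mem_rank_of_mem hx⟩).1 hx, fun hx => (H ⟨x, hs v hx⟩).2 hx⟩⟩

end Quantifiers

theorem subset (i j : α) : Expressible fun v : α → Rank lam => (v i).1 ⊆ (v j).1 :=
  ball i (mem _ _)

theorem eq_empty (i : α) : Expressible fun v : α → Rank lam => (v i).1 = ∅ :=
  (ball i (S := fun _ _ => False) ((eq (.inl i) (.inl i)).not.congr fun _ => by simp)).congr
    fun _ => ZFSet.eq_empty _

theorem eq_insert (i j k : α) :
    Expressible fun v : α → Rank lam => (v i).1 = insert (v j).1 (v k).1 := by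
  refine eq_of_subset i (fun v x hx => ?_) (((eq _ _).or (mem _ _)).congr fun _ => mem_insert_iff)
  rcases mem_insert_iff.1 hx with rfl | hx
  exacts [(v j).2, mem_rank_of_mem hx]

theorem eq_upair (i j k : α) :
    Expressible fun v : α → Rank lam => (v i).1 = {(v j).1, (v k).1} := by
  refine eq_of_subset i (fun v x hx => ?_) (((eq _ _).or (eq _ _)).congr fun _ => mem_pair)
  rcases mem_pair.1 hx with rfl | rfl
  exacts [(v j).2, (v k).2]

theorem eq_pair (i j k : α) :
    Expressible fun v : α → Rank lam => (v i).1 = pair (v j).1 (v k).1 := by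
  refine congr (P := fun v => ∃ s ∈ (v i).1, ∃ t ∈ (v i).1, s = {(v j).1, (v j).1} ∧
    t = {(v j).1, (v k).1} ∧ (v i).1 = {s, t}) ?_ fun v => ?_
  · exact bex i (bex _ ((eq_upair _ _ _).and ((eq_upair _ _ _).and (eq_upair _ _ _))))
  · refine ⟨fun h => ⟨{(v j).1, (v j).1}, ?_, {(v j).1, (v k).1}, ?_, rfl, rfl, ?_⟩, ?_⟩
    iterate 3 simp [h, pair]
    rintro ⟨s, -, t, -, rfl, rfl, h⟩
    simp [h, pair]

theorem pair_mem (i j k : α) :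
    Expressible fun v : α → Rank lam => pair (v i).1 (v j).1 ∈ (v k).1 :=
  (bex (S := fun v x => x = pair (v i).1 (v j).1) k (eq_pair _ _ _)).congr fun _ =>
    ⟨fun h => ⟨_, h, rfl⟩, fun ⟨_, h, hs⟩ => hs ▸ h⟩

theorem isTransitive (i : α) : Expressible fun v : α → Rank lam => (v i).1.IsTransitive :=
  ball i (subset _ _)

theorem isOrdinal (i : α) : Expressible fun v : α → Rank lam => (v i).1.IsOrdinal :=
  ((isTransitive i).and (ball i (isTransitive _))).congr fun _ =>
    isOrdinal_iff_forall_mem_isTransitive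

end Expressible

/-- `x` is the accumulation of `s`: the set of all subsets of elements of `s`. -/
def IsAccumulation (x s : ZFSet.{u}) : Prop :=
  ∀ y, y ∈ x ↔ ∃ z ∈ s, y ⊆ z

/-- `s` is a history in the sense of Scott and Potter: each `x ∈ s` is the accumulation of the
elements of `s` that precede it. Accumulations of histories are exactly the sets `V_a`, which
describes the cumulative hierarchy without recursion along the ordinals. -/
def IsHistory (s : ZFSet.{u}) : Prop :=
  ∀ x ∈ s, IsAccumulation x (s ∩ x)

theorem IsAccumulation.eq_vonNeumann {x s : ZFSet.{u}} (hx : IsAccumulation x s)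
    (hs : ∀ z ∈ s, z = V_ z.rank) : x = V_ x.rank := by
  ext y
  rw [mem_vonNeumann, lt_rank_iff]
  refine ⟨fun hy => ⟨y, hy, le_rfl⟩, ?_⟩
  rintro ⟨w, hw, hyw⟩
  obtain ⟨z, hz, hwz⟩ := (hx w).1 hw
  refine (hx y).2 ⟨z, hz, ?_⟩
  rw [hs z hz, subset_vonNeumann]
  exact hyw.trans (rank_mono hwz)

theorem IsHistory.eq_vonNeumann {s : ZFSet.{u}} (hs : IsHistory s) {x : ZFSet.{u}}
    (hx : x ∈ s) : x = V_ x.rank := by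
  induction x using ZFSet.inductionOn with
  | h x ih =>
    refine (hs x hx).eq_vonNeumann fun z hz => ?_
    rw [mem_inter] at hz
    exact ih z hz.2 hz.1

theorem exists_isHistory_isAccumulation (a : Ordinal.{u}) :
    ∃ s ⊆ V_ a, IsHistory s ∧ IsAccumulation (V_ a) s := by
  refine ⟨ZFSet.range fun b : Set.Iio a => V_ b.1, ?_, ?_, fun y => by simp [mem_vonNeumann']⟩
  · intro x hx
    obtain ⟨b, rfl⟩ := mem_range.1 hx
    exact vonNeumann_mem_of_lt b.2
  · intro x hx y
    obtain ⟨b, rfl⟩ := mem_range.1 hx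
    simp only [mem_inter, mem_range, Subtype.exists, Set.mem_Iio, exists_prop, and_assoc,
      exists_exists_and_eq_and, vonNeumann_mem_vonNeumann_iff]
    rw [mem_vonNeumann']
    exact ⟨fun ⟨c, hc, h⟩ => ⟨c, hc.trans b.2, hc, h⟩, fun ⟨c, _, hc, h⟩ => ⟨c, hc, h⟩⟩

theorem exists_eq_vonNeumann_iff {x : ZFSet.{u}} :
    (∃ a, x = V_ a) ↔ ∃ s ⊆ x, IsHistory s ∧ IsAccumulation x s := by
  constructor
  · rintro ⟨a, rfl⟩
    exact exists_isHistory_isAccumulation a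
  · rintro ⟨s, -, hs, hx⟩
    exact ⟨_, hx.eq_vonNeumann fun _ => hs.eq_vonNeumann⟩

namespace Expressible

theorem isAccumulation (i j : α) :
    Expressible fun v : α → Rank lam => IsAccumulation (v i).1 (v j).1 := by
  refine (all (R := fun v y => y.1 ∈ (v i).1 ↔ ∃ z ∈ (v j).1, y.1 ⊆ z)
    ((mem _ _).iff (bex _ (subset _ _)))).congr fun v => ⟨fun H y => H y.1, fun H y => ⟨?_, ?_⟩⟩
  · exact fun hy => (H ⟨y, mem_rank_of_mem hy⟩).1 hy
  · rintro ⟨z, hz, hyz⟩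
    exact (H ⟨y, mem_vonNeumann_of_subset hyz (mem_rank_of_mem hz)⟩).2 ⟨z, hz, hyz⟩

theorem eq_inter (i j k : α) :
    Expressible fun v : α → Rank lam => (v i).1 = (v j).1 ∩ (v k).1 :=
  eq_of_subset i (fun _ _ hx => mem_rank_of_mem (mem_inter.1 hx).1)
    (((mem _ _).and (mem _ _)).congr fun _ => mem_inter)

theorem isHistory (i : α) : Expressible fun v : α → Rank lam => IsHistory (v i).1 := by
  refine ball i ((ex (R := fun w t => t.1 = (w (.inl i)).1 ∩ (w (.inr ())).1 ∧
    IsAccumulation (w (.inr ())).1 t.1) ((eq_inter _ _ _).and (isAccumulation _ _))).congr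
    fun w => ⟨fun h => ?_, fun ⟨_, ht, h⟩ => ht ▸ h⟩)
  exact ⟨⟨_, mem_vonNeumann_of_subset (fun _ hx => (mem_inter.1 hx).1) (w (.inl i)).2⟩, rfl, h⟩

theorem exists_eq_vonNeumann (i : α) :
    Expressible fun v : α → Rank lam => ∃ a, (v i).1 = V_ a := by
  refine (ex (R := fun v s => s.1 ⊆ (v i).1 ∧ IsHistory s.1 ∧ IsAccumulation (v i).1 s.1)
    ((subset _ _).and ((isHistory _).and (isAccumulation _ _)))).congr fun v => ?_
  rw [exists_eq_vonNeumann_iff]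
  exact ⟨fun ⟨s, hs, h⟩ => ⟨⟨s, mem_vonNeumann_of_subset hs (v i).2⟩, hs, h⟩,
    fun ⟨s, h⟩ => ⟨s.1, h⟩⟩

end Expressible

theorem mem_toZFSet_iff_mem_vonNeumann {a : Ordinal.{u}} {x : ZFSet.{u}} :
    x ∈ a.toZFSet ↔ x.IsOrdinal ∧ x ∈ V_ a := by
  constructor
  · exact fun hx => ⟨(isOrdinal_toZFSet a).mem hx, Ordinal.toZFSet_subset_vonNeumann a hx⟩
  · rintro ⟨hx, hxa⟩
    rwa [← hx.rank_lt_iff_mem (isOrdinal_toZFSet a), Ordinal.rank_toZFSet, ← mem_vonNeumann]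

theorem Expressible.eq_vonNeumann_eq_toZFSet (i j : α) :
    Expressible fun v : α → Rank lam => ∃ a, (v i).1 = V_ a ∧ (v j).1 = a.toZFSet := by
  refine ((exists_eq_vonNeumann i).and (all (R := fun v x => x.1 ∈ (v j).1 ↔
    x.1.IsOrdinal ∧ x.1 ∈ (v i).1) ((mem _ _).iff ((isOrdinal _).and (mem _ _))))).congr
    fun v => ⟨?_, ?_⟩
  · rintro ⟨a, hi, hj⟩
    exact ⟨⟨a, hi⟩, fun x => by rw [hi, hj, mem_toZFSet_iff_mem_vonNeumann]⟩
  · rintro ⟨⟨a, hi⟩, h⟩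
    refine ⟨a, hi, ZFSet.ext fun x => ?_⟩
    rw [mem_toZFSet_iff_mem_vonNeumann, ← hi]
    exact ⟨fun hx => (h ⟨x, mem_rank_of_mem hx⟩).1 hx,
      fun hx => (h ⟨x, mem_rank_of_mem hx.2⟩).2 hx⟩

/-- The set `V_a` as an element of `V_lam`. -/
noncomputable def level (a : Set.Iio lam) : Rank lam :=
  ⟨V_ a.1, vonNeumann_mem_of_lt a.2⟩

/-- The von Neumann ordinal `a` as an element of `V_lam`. -/
noncomputable def ord (a : Set.Iio lam) : Rank lam :=
  ⟨a.1.toZFSet, by rw [mem_vonNeumann, Ordinal.rank_toZFSet]; exact a.2⟩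

theorem ord_mem_ord {a b : Set.Iio lam} : (ord a).1 ∈ (ord b).1 ↔ a < b :=
  Ordinal.toZFSet_mem_toZFSet_iff

theorem ord_injective : Function.Injective (ord (lam := lam)) := fun _ _ h =>
  Subtype.ext (Ordinal.toZFSet_injective (congrArg Subtype.val h))

theorem mem_ord {x : Rank lam} {a : Set.Iio lam} : x.1 ∈ (ord a).1 ↔ ∃ b < a, x = ord b := by
  constructor
  · intro hx
    obtain ⟨b, hb, hbx⟩ := Ordinal.mem_toZFSet_iff.1 hx
    exact ⟨⟨b, hb.trans a.2⟩, hb, Subtype.ext hbx.symm⟩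
  · rintro ⟨b, hb, rfl⟩
    exact ord_mem_ord.2 hb

section ordMap

variable (e : Rank lam ↪ₑ[setLang] Rank lam)

theorem map_mem_iff (x y : Rank lam) : (e x).1 ∈ (e y).1 ↔ x.1 ∈ y.1 :=
  (Expressible.mem 0 1).map_iff e ![x, y]

theorem map_subset_iff (x y : Rank lam) : (e x).1 ⊆ (e y).1 ↔ x.1 ⊆ y.1 :=
  (Expressible.subset 0 1).map_iff e ![x, y]

theorem pair_map_mem_iff (x y z : Rank lam) :
    pair (e x).1 (e y).1 ∈ (e z).1 ↔ pair x.1 y.1 ∈ z.1 :=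
  (Expressible.pair_mem 0 1 2).map_iff e ![x, y, z]

theorem exists_map_level_map_ord (a : Set.Iio lam) :
    ∃ b, e (level a) = level b ∧ e (ord a) = ord b := by
  obtain ⟨b, hb, hb'⟩ := ((Expressible.eq_vonNeumann_eq_toZFSet 0 1).map_iff e
    ![level a, ord a]).2 ⟨a, rfl, rfl⟩
  change (e (level a)).1 = V_ b at hb
  have hlt : b < lam := by simpa [hb] using rank_lt (e (level a))
  exact ⟨⟨b, hlt⟩, Subtype.ext hb, Subtype.ext hb'⟩

/-- The action of an elementary embedding of `V_lam` on the ordinals below `lam`. -/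
noncomputable def ordMap (a : Set.Iio lam) : Set.Iio lam :=
  (exists_map_level_map_ord e a).choose

theorem map_level (a : Set.Iio lam) : e (level a) = level (ordMap e a) :=
  (exists_map_level_map_ord e a).choose_spec.1

theorem map_ord (a : Set.Iio lam) : e (ord a) = ord (ordMap e a) :=
  (exists_map_level_map_ord e a).choose_spec.2

theorem ordMap_strictMono : StrictMono (ordMap e) := fun a b hab => by
  rwa [← ord_mem_ord, ← map_ord, ← map_ord, map_mem_iff, ord_mem_ord]

theorem map_eq_self {x : Rank lam} (h : ∀ a : Set.Iio lam, a.1 ≤ x.1.rank → ordMap e a = a) :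
    e x = x := by
  induction hr : x.1.rank using WellFoundedLT.induction generalizing x with
  | _ r ih =>
    subst hr
    have hfix (y : Rank lam) (hy : y.1.rank < x.1.rank) : e y = y :=
      ih _ hy (fun a ha => h a (ha.trans hy.le)) rfl
    have hsub : (e x).1 ⊆ V_ x.1.rank := by
      have := (map_subset_iff e x (level ⟨_, rank_lt x⟩)).2 (subset_vonNeumann.2 le_rfl)
      rwa [map_level, h _ le_rfl] at this
    refine rank_ext fun z => ⟨fun hz => ?_, fun hz => ?_⟩
    · rwa [← map_mem_iff e, hfix z (mem_vonNeumann.1 (hsub hz))]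
    · rwa [← hfix z (rank_lt_of_mem hz), map_mem_iff]

end ordMap

section graph

variable {f : Rank lam → Rank lam}

theorem pair_mem_graph {x y : ZFSet.{u}} :
    pair x y ∈ graph f ↔ ∃ h : x ∈ V_ lam, (f ⟨x, h⟩).1 = y := by
  simp only [graph, mem_range, pair_inj]
  exact ⟨fun ⟨z, hz, h⟩ => hz ▸ ⟨z.2, h⟩, fun ⟨h, h'⟩ => ⟨⟨x, h⟩, rfl, h'⟩⟩

theorem pair_mem_graph_iff {x y : Rank lam} : pair x.1 y.1 ∈ graph f ↔ f x = y := by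
  rw [pair_mem_graph]
  exact ⟨fun ⟨_, h⟩ => Subtype.ext h, fun h => ⟨x.2, congrArg _ h⟩⟩

theorem mem_rng_graph {y : ZFSet.{u}} : y ∈ rng (graph f) ↔ ∃ x, (f x).1 = y := by
  simp only [rng, Set.mem_ofPred_eq, pair_mem_graph]
  exact ⟨fun ⟨x, h, h'⟩ => ⟨⟨x, h⟩, h'⟩, fun ⟨x, h⟩ => ⟨x.1, x.2, h⟩⟩

theorem val_eq {F x y : ZFSet.{u}} (hy : pair x y ∈ F) (h : ∀ z, pair x z ∈ F → z = y) :
    val F x = y := by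
  have : (⋃₀ (⋃₀ F : ZFSet.{u}) : ZFSet.{u}).sep (fun y => pair x y ∈ F) = {y} := by
    ext z
    rw [mem_sep, mem_singleton]
    refine ⟨fun hz => h z hz.2, ?_⟩
    rintro rfl
    refine ⟨mem_sUnion.2 ⟨{x, z}, mem_sUnion.2 ⟨_, hy, ?_⟩, ?_⟩, hy⟩ <;> simp [pair]
  rw [val, this, sUnion_singleton]

theorem val_graph (f : Rank lam → Rank lam) (x : Rank lam) : val (graph f) x.1 = (f x).1 :=
  val_eq (pair_mem_graph_iff.2 rfl) fun _ hz => (pair_mem_graph.1 hz).2.symm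

end graph

theorem not_isSuccLimit_iff {a : Ordinal.{u}} : ¬ Order.IsSuccLimit a ↔
    a.toZFSet = ∅ ∨ ∃ y ∈ a.toZFSet, a.toZFSet = insert y y := by
  constructor
  · intro h
    rcases Ordinal.zero_or_succ_or_isSuccLimit a with rfl | ⟨b, rfl⟩ | ha
    · exact .inl Ordinal.toZFSet_zero
    · refine .inr ⟨b.toZFSet, ?_, Ordinal.toZFSet_add_one b⟩
      exact Ordinal.toZFSet_mem_toZFSet_iff.2 (Order.lt_succ b)
    · exact absurd ha h
  · rintro (h | ⟨y, hy, h⟩) ha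
    · rw [← Ordinal.toZFSet_zero] at h
      exact ha.ne_bot (Ordinal.toZFSet_injective h)
    · obtain ⟨b, hb, rfl⟩ := Ordinal.mem_toZFSet_iff.1 hy
      rw [← Ordinal.toZFSet_add_one] at h
      exact (ha.add_one_lt hb).ne (Ordinal.toZFSet_injective h).symm

section crit

variable {e : Rank lam ↪ₑ[setLang] Rank lam} {κ a : Set.Iio lam}

/-- `κ` is the critical point of `e`: the least ordinal that `e` moves. It agrees with `crit`, by
`IsCrit.crit_graph`, and always exists for nontrivial `e`, by `exists_isCrit`. -/
def IsCrit (e : Rank lam ↪ₑ[setLang] Rank lam) (κ : Set.Iio lam) : Prop :=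
  IsLeast {a | a < ordMap e a} κ

theorem exists_isCrit (he : ∃ x, e x ≠ x) : ∃ κ, IsCrit e κ := by
  obtain ⟨x, hx⟩ := he
  have hne : {a | a < ordMap e a}.Nonempty := by
    contrapose! hx
    refine map_eq_self e fun a _ => ((ordMap_strictMono e).le_apply).antisymm' ?_
    exact not_lt.1 fun h => Set.notMem_empty a (hx ▸ h)
  obtain ⟨κ, hκ, hmin⟩ := wellFounded_lt.has_min _ hne
  exact ⟨κ, hκ, fun a ha => not_lt.1 (hmin a ha)⟩

theorem toZFSet_mem_val_graph :
    a.1.toZFSet ∈ val (graph e) a.1.toZFSet ↔ a < ordMap e a := by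
  rw [show val (graph e) a.1.toZFSet = _ from val_graph e (ord a), map_ord]
  exact ord_mem_ord

namespace IsCrit

theorem crit_graph (h : IsCrit e κ) : crit (graph e) = κ.1 := by
  refine IsLeast.csInf_eq ⟨toZFSet_mem_val_graph.2 h.1, fun a ha => ?_⟩
  by_contra! hlt
  exact (h.2 (toZFSet_mem_val_graph (a := ⟨a, hlt.trans κ.2⟩).1 ha)).not_gt hlt

theorem ordMap_eq (h : IsCrit e κ) (ha : a < κ) : ordMap e a = a :=
  ((ordMap_strictMono e).le_apply).antisymm' (not_lt.1 fun h' => (h.2 h').not_gt ha)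

theorem map_ord_eq (h : IsCrit e κ) (ha : a < κ) : e (ord a) = ord a := by
  rw [map_ord, h.ordMap_eq ha]

theorem map_eq (h : IsCrit e κ) {x : Rank lam} (hx : x.1.rank < κ) : e x = x :=
  map_eq_self e fun _ ha => h.ordMap_eq (ha.trans_lt hx)

theorem notMem_range_ordMap (h : IsCrit e κ) : κ ∉ Set.range (ordMap e) := by
  rintro ⟨a, ha⟩
  rcases lt_or_ge a κ with haκ | haκ
  · exact haκ.ne ((h.ordMap_eq haκ).symm.trans ha)
  · exact (h.1.trans_le ((ordMap_strictMono e).monotone haκ)).ne' ha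

theorem isSuccLimit (h : IsCrit e κ) : Order.IsSuccLimit κ.1 := by
  by_contra hκ
  suffices e (ord κ) = ord κ from h.1.ne' (ord_injective ((map_ord e κ).symm.trans this))
  rcases not_isSuccLimit_iff.1 hκ with h0 | ⟨y, hy, hs⟩
  · exact Subtype.ext ((((Expressible.eq_empty 0).map_iff e ![ord κ]).2 h0).trans h0.symm)
  · obtain ⟨b, hb, hyb⟩ := (mem_ord (x := ⟨y, mem_rank_of_mem (y := ord κ) hy⟩)).1 hy
    obtain rfl : y = (ord b).1 := congrArg Subtype.val hyb
    have he : (e (ord κ)).1 = insert (e (ord b)).1 (e (ord b)).1 :=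
      ((Expressible.eq_insert 0 1 1).map_iff e ![ord κ, ord b]).2 hs
    rw [h.map_ord_eq hb] at he
    exact Subtype.ext (he.trans hs.symm)

/-- If `κ = ω`, then by elementarity no element of `e(κ)` is a limit ordinal; but `κ ∈ e(κ)`. -/
theorem omega0_lt (h : IsCrit e κ) : Ordinal.omega0 < κ.1 := by
  refine (Ordinal.omega0_le_of_isSuccLimit h.isSuccLimit).lt_of_ne fun hκ => ?_
  have hE : Expressible fun v : Fin 1 → Rank lam =>
      ∀ x ∈ (v 0).1, x = ∅ ∨ ∃ y ∈ x, x = insert y y :=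
    .ball _ (.or (.eq_empty _) (.bex _ (.eq_insert _ _ _)))
  have hω : ∀ x ∈ (ord κ).1, x = ∅ ∨ ∃ y ∈ x, x = insert y y := by
    intro x hx
    obtain ⟨a, ha, rfl⟩ := Ordinal.mem_toZFSet_iff.1 hx
    refine not_isSuccLimit_iff.1 fun hlim => ?_
    exact (Ordinal.omega0_le_of_isSuccLimit hlim).not_gt (hκ ▸ ha)
  have hmem : (ord κ).1 ∈ (e (ord κ)).1 := by rw [map_ord]; exact ord_mem_ord.2 h.1
  exact not_isSuccLimit_iff.2 ((hE.map_iff e ![ord κ]).2 hω _ hmem) h.isSuccLimit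

end IsCrit

end crit

/-- The part of the graph of `f` in `V_a`, as an element of `V_lam`. -/
noncomputable def graphPart (f : Rank lam → Rank lam) (a : Set.Iio lam) : Rank lam :=
  ⟨graph f ∩ V_ a.1, mem_vonNeumann_of_subset (fun _ hx => (mem_inter.1 hx).2)
    (vonNeumann_mem_of_lt a.2)⟩

theorem pair_mem_graphPart {f : Rank lam → Rank lam} {a : Set.Iio lam} {x y : Rank lam} :
    pair x.1 y.1 ∈ (graphPart f a).1 ↔ f x = y ∧ pair x.1 y.1 ∈ V_ a.1 :=
  mem_inter.trans (and_congr_left fun _ => pair_mem_graph_iff)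

theorem mem_app_graph {e f : Rank lam → Rank lam} {z : ZFSet.{u}} :
    z ∈ app lam (graph e) (graph f) ↔ ∃ a, z ∈ (e (graphPart f a)).1 := by
  rw [app, mem_iUnion]
  exact exists_congr fun a => by rw [← val_graph]; rfl

section application

variable {e f : Rank lam ↪ₑ[setLang] Rank lam}

theorem graphPart_mono {a b : Set.Iio lam} (hab : a ≤ b) :
    (e (graphPart f a)).1 ⊆ (e (graphPart f b)).1 := by
  rw [map_subset_iff]
  intro x hx
  obtain ⟨h1, h2⟩ := mem_inter.1 hx
  exact mem_inter.2 ⟨h1, vonNeumann_subset_of_le hab h2⟩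

theorem exists_eq_pair_of_mem_app {z : ZFSet.{u}} (hz : z ∈ app lam (graph e) (graph f)) :
    ∃ x y : Rank lam, z = pair x.1 y.1 := by
  obtain ⟨a, ha⟩ := mem_app_graph.1 hz
  have hE : Expressible fun v : Fin 1 → Rank lam =>
      ∀ z ∈ (v 0).1, ∃ x y : Rank lam, z = pair x.1 y.1 :=
    .ball _ (.ex (.ex (.eq_pair _ _ _)))
  refine (hE.map_iff e ![graphPart f a]).2 (fun z hz => ?_) z ha
  obtain ⟨x, hx⟩ := mem_range.1 (mem_inter.1 hz).1
  exact ⟨x, f x, hx.symm⟩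

theorem pair_map_mem_app (hlam : Order.IsSuccLimit lam) (x : Rank lam) :
    pair (e x).1 (e (f x)).1 ∈ app lam (graph e) (graph f) := by
  let a : Set.Iio lam := ⟨_, hlam.succ_lt (rank_lt ⟨_, pair_mem_vonNeumann hlam x.2 (f x).2⟩)⟩
  refine mem_app_graph.2 ⟨a, (pair_map_mem_iff e _ _ _).2 (pair_mem_graphPart.2 ⟨rfl, ?_⟩)⟩
  exact mem_vonNeumann_succ _

theorem iff_of_pair_mem_app (hlam : Order.IsSuccLimit lam) [Finite α]
    {P : (α → Rank lam) → Prop} (hP : Expressible P)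
    {v w : α → Rank lam} (hvw : ∀ i, pair (v i).1 (w i).1 ∈ app lam (graph e) (graph f)) :
    P v ↔ P w := by
  have : Nonempty (Set.Iio lam) := ⟨⟨0, hlam.bot_lt⟩⟩
  choose b hb using fun i => mem_app_graph.1 (hvw i)
  obtain ⟨a, ha⟩ := Finite.exists_le b
  have hE : Expressible fun g : Fin 1 → Rank lam => ∀ v w : α → Rank lam,
      (∀ i, pair (v i).1 (w i).1 ∈ (g 0).1) → (P v ↔ P w) :=
    .forall_tuple (.forall_tuple (.imp (.forall_finite fun i => .pair_mem _ _ _)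
      (.iff (hP.comp _) (hP.comp _))))
  refine (hE.map_iff e ![graphPart f a]).2 ?_ v w fun i => graphPart_mono (ha i) (hb i)
  intro v w h
  obtain rfl : (fun i => f (v i)) = w := funext fun i => (pair_mem_graphPart.1 (h i)).1
  exact (hP.map_iff f v).symm

theorem exists_pair_mem_app (hlam : Order.IsSuccLimit lam) (x : Rank lam) :
    ∃ y : Rank lam, pair x.1 y.1 ∈ app lam (graph e) (graph f) := by
  let b : Set.Iio lam := ⟨Order.succ x.1.rank, hlam.succ_lt (rank_lt x)⟩
  -- `V_a` contains the whole graph of `f` on `V_b`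
  let a : Set.Iio lam := ⟨_, hlam.succ_lt (hlam.succ_lt (max b (ordMap f b)).2)⟩
  have hE : Expressible fun v : Fin 2 → Rank lam =>
      ∀ x : Rank lam, x.1 ∈ (v 0).1 → ∃ y : Rank lam, pair x.1 y.1 ∈ (v 1).1 :=
    .all (.imp (.mem _ _) (.ex (.pair_mem _ _ _)))
  have htotal : ∀ x : Rank lam, x.1 ∈ (level b).1 →
      ∃ y : Rank lam, pair x.1 y.1 ∈ (graphPart f a).1 := by
    intro x hx
    refine ⟨f x, pair_mem_graphPart.2 ⟨rfl, ?_⟩⟩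
    have hfx : (f x).1 ∈ (level (ordMap f b)).1 := by rwa [← map_level, map_mem_iff]
    exact pair_mem_vonNeumann_succ_succ (vonNeumann_subset_of_le (le_max_left b (ordMap f b)) hx)
      (vonNeumann_subset_of_le (le_max_right b (ordMap f b)) hfx)
  have hx : x.1 ∈ (e (level b)).1 := by
    rw [map_level]
    exact vonNeumann_subset_of_le ((ordMap_strictMono e).le_apply) (mem_vonNeumann_succ _)
  obtain ⟨y, hy⟩ := (hE.map_iff e ![level b, graphPart f a]).2 htotal x hx
  exact ⟨y, mem_app_graph.2 ⟨a, hy⟩⟩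

theorem exists_embedding_app (hlam : Order.IsSuccLimit lam) :
    ∃ g : Rank lam ↪ₑ[setLang] Rank lam, app lam (graph e) (graph f) = graph g := by
  choose g hg using exists_pair_mem_app (e := e) (f := f) hlam
  let G : Rank lam ↪ₑ[setLang] Rank lam := ⟨g, fun n φ v => by
    exact (iff_of_pair_mem_app hlam (P := φ.Realize) ⟨φ, fun _ => Iff.rfl⟩ fun i => hg (v i)).symm⟩
  refine ⟨G, ZFSet.ext fun z => ⟨fun hz => ?_, fun hz => ?_⟩⟩
  · obtain ⟨x, y, rfl⟩ := exists_eq_pair_of_mem_app hz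
    have hxy := iff_of_pair_mem_app hlam (e := e) (f := f) (Expressible.eq (0 : Fin 2) 1)
      (v := ![x, x]) (w := ![g x, y]) fun i => by fin_cases i; exacts [hg x, hz]
    exact pair_mem_graph_iff.2 (Subtype.ext (hxy.1 rfl))
  · obtain ⟨x, rfl⟩ := mem_range.1 hz
    exact hg x

theorem app_mem_emb (hlam : Order.IsSuccLimit lam) {j k : ZFSet.{u}} (hj : j ∈ Emb lam)
    (hk : k ∈ Emb lam) : app lam j k ∈ Emb lam := by
  obtain ⟨e, -, rfl⟩ := hj
  obtain ⟨f, ⟨x, hx⟩, rfl⟩ := hk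
  obtain ⟨g, hg⟩ := exists_embedding_app (e := e) (f := f) hlam
  refine ⟨g, ⟨e x, fun hgx => hx ?_⟩, hg⟩
  have hmap := pair_map_mem_app (e := e) (f := f) hlam x
  rw [hg, pair_mem_graph_iff, hgx] at hmap
  exact (e.injective hmap).symm

theorem leftProd_mem_emb (hlam : Order.IsSuccLimit lam) {j : ZFSet.{u}} (hj : j ∈ Emb lam)
    {js : ℕ → ZFSet.{u}} {n : ℕ} (hjs : ∀ i < n, js i ∈ Emb lam) :
    leftProd lam j js n ∈ Emb lam := by
  induction n with
  | zero => exact hj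
  | succ n ih =>
    exact app_mem_emb hlam (ih fun i hi => hjs i (hi.trans n.lt_succ_self)) (hjs n n.lt_succ_self)

end application

theorem exists_injective_mem {ι T : Type u} (S : ι → Set T) (hS : ∀ i, #ι ≤ #(S i)) :
    ∃ s : ι → T, Function.Injective s ∧ ∀ i, s i ∈ S i := by
  obtain ⟨r, hr, hord⟩ := exists_ord_eq ι
  have hlt (i : ι) : #{j // r j i} < #ι := by
    have := Ordinal.typein_lt_type r i
    rwa [← hord, lt_ord] at this
  have hnew (i : ι) (s : ∀ j, r j i → T) : ∃ t ∈ S i, ∀ j h, t ≠ s j h := by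
    by_contra! h
    have hsub : S i ⊆ Set.range fun j : {j // r j i} => s j.1 j.2 := fun t ht => by
      obtain ⟨j, hj, hjt⟩ := h t ht
      exact ⟨⟨j, hj⟩, hjt.symm⟩
    exact (((hS i).trans (mk_le_mk_of_subset hsub)).trans mk_range_le).not_gt
      (hlt i)
  choose t ht hne using hnew
  have hwf : WellFounded r := hr.wf
  let s : ι → T := hwf.fix t
  have hs (i : ι) : s i = t i fun j _ => s j := hwf.fix_eq t i
  refine ⟨s, fun i j hij => ?_, fun i => hs i ▸ ht i _⟩
  by_contra h
  rcases trichotomous_of r i j with h' | h' | h'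
  · exact hne j (fun k _ => s k) i h' ((hs j).symm.trans hij.symm)
  · exact h h'
  · exact hne i (fun k _ => s k) j h' ((hs i).symm.trans hij)

theorem mk_injective_prod_le {X : Type u} [Infinite X] :
    #({g : X → X // Function.Injective g} × X) ≤ #(Set X) := by
  have hX := aleph0_le_mk X
  have hinj : #{g : X → X // Function.Injective g} ≤ 2 ^ #X := by
    rw [← power_self_eq hX, power_def]
    exact mk_subtype_le _
  rw [mk_prod, lift_id, lift_id, mk_set]
  refine (mul_le_mul' hinj (cantor _).le).trans_eq (mul_eq_self ?_)
  exact hX.trans (cantor _).le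

theorem exists_jonsson_function {I X : Type u} [Infinite X] (hX : #(Set X) ≤ #(I → X)) :
    ∃ F : (I → X) → X, ∀ g : X → X, Function.Injective g → ∀ y, ∃ t : I → X, F (g ∘ t) = y := by
  obtain ⟨s, hs, hs'⟩ := exists_injective_mem
    (fun i : {g : X → X // Function.Injective g} × X => Set.range fun t : I → X => i.1.1 ∘ t)
    fun i => by
      rw [mk_range_eq _ i.1.2.comp_left]
      exact mk_injective_prod_le.trans hX
  refine ⟨Function.extend s Prod.snd fun _ => Classical.arbitrary X, fun g hg y => ?_⟩
  obtain ⟨t, ht : g ∘ t = s (⟨g, hg⟩, y)⟩ := hs' (⟨g, hg⟩, y)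
  exact ⟨t, by rw [ht, hs.extend_apply]⟩

theorem mk_set_le_mk_fun {I X : Type u} (S : I → Set X) (hS : ∀ x, ∃ i, x ∈ S i)
    (hcard : ∀ i, #(Set (S i)) ≤ #X) : #(Set X) ≤ #(I → X) := by
  have f (i : I) : Set (S i) ↪ X := (hcard i).some
  refine ⟨fun A i => f i {x | x.1 ∈ A}, fun A B h => Set.ext fun x => ?_⟩
  obtain ⟨i, hi⟩ := hS x
  exact Set.ext_iff.1 ((f i).injective (congrFun h i)) ⟨x, hi⟩

/-- The relation `f` is single-valued: it is a set function as far as its ordered pairs go. -/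
def IsSingleValued (f : Rank lam) : Prop :=
  ∀ x y y' : Rank lam, pair x.1 y.1 ∈ f.1 → pair x.1 y'.1 ∈ f.1 → y.1 = y'.1

theorem Expressible.isSingleValued (i : α) :
    Expressible fun v : α → Rank lam => IsSingleValued (v i) :=
  .all (.all (.all ((pair_mem _ _ _).imp ((pair_mem _ _ _).imp (eq _ _)))))

theorem IsSingleValued.map {f : Rank lam} (hf : IsSingleValued f)
    (e : Rank lam ↪ₑ[setLang] Rank lam) : IsSingleValued (e f) :=
  ((Expressible.isSingleValued 0).map_iff e ![f]).2 hf

section funSet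

variable {ι : Type v} [Small.{u} ι] {a b : ι → Rank lam}

/-- The relation `{⟨a i, b i⟩ : i ∈ ι}`, a function if `a` is injective. -/
noncomputable def funSet (a b : ι → Rank lam) : ZFSet.{u} :=
  ZFSet.range fun i => pair (a i).1 (b i).1

theorem pair_mem_funSet {x y : Rank lam} :
    pair x.1 y.1 ∈ funSet a b ↔ ∃ i, a i = x ∧ b i = y := by
  simp only [funSet, mem_range, pair_inj, Subtype.ext_iff]

theorem pair_mem_funSet_of_injective (ha : Function.Injective a) {i : ι} {y : Rank lam} :
    pair (a i).1 y.1 ∈ funSet a b ↔ b i = y := by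
  rw [pair_mem_funSet]
  exact ⟨fun ⟨_, hj, h⟩ => ha hj ▸ h, fun h => ⟨i, rfl, h⟩⟩

theorem isSingleValued_funSet (ha : Function.Injective a) (h : funSet a b ∈ V_ lam) :
    IsSingleValued ⟨funSet a b, h⟩ := by
  intro x y y' hy hy'
  obtain ⟨i, rfl, rfl⟩ := pair_mem_funSet.1 hy
  exact congrArg Subtype.val ((pair_mem_funSet_of_injective ha).1 hy')

theorem funSet_mem_vonNeumann {c : Ordinal.{u}} (ha : ∀ i, (a i).1 ∈ V_ c)
    (hb : ∀ i, (b i).1 ∈ V_ c) :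
    funSet a b ∈ V_ (Order.succ (Order.succ (Order.succ c))) := by
  rw [mem_vonNeumann, Order.lt_succ_iff, ← subset_vonNeumann]
  intro z hz
  obtain ⟨i, rfl⟩ := mem_range.1 hz
  exact pair_mem_vonNeumann_succ_succ (ha i) (hb i)

theorem funSet_mem_rank (hlam : Order.IsSuccLimit lam) {c : Ordinal.{u}} (hc : c < lam)
    (ha : ∀ i, (a i).1 ∈ V_ c) (hb : ∀ i, (b i).1 ∈ V_ c) : funSet a b ∈ V_ lam :=
  vonNeumann_subset_of_le (hlam.succ_lt (hlam.succ_lt (hlam.succ_lt hc))).le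
    (funSet_mem_vonNeumann ha hb)

end funSet

section ordFun

theorem ord_mem_vonNeumann {a : Set.Iio lam} {c : Ordinal.{u}} : (ord a).1 ∈ V_ c ↔ a < c := by
  rw [mem_vonNeumann, ord, Ordinal.rank_toZFSet]

variable {hlam : Order.IsSuccLimit lam} {w l : Set.Iio lam}

theorem injective_ord_coe : Function.Injective fun n : Set.Iio w => ord n.1 :=
  ord_injective.comp Subtype.val_injective

theorem funSet_ord_mem_vonNeumann (s : Set.Iio w → Set.Iio l) :
    funSet (fun n : Set.Iio w => ord n.1) (fun n => ord (s n).1) ∈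
      V_ (Order.succ (Order.succ (Order.succ (max w l).1))) :=
  funSet_mem_vonNeumann (fun n => ord_mem_vonNeumann.2 (n.2.trans_le (le_max_left w l)))
    fun n => ord_mem_vonNeumann.2 ((s n).2.trans_le (le_max_right w l))

variable (hlam) in
/-- The set function from the ordinal `w` to the ordinal `l` that represents `s`. -/
noncomputable def ordFun (s : Set.Iio w → Set.Iio l) : Rank lam :=
  ⟨_, vonNeumann_subset_of_le (hlam.succ_lt (hlam.succ_lt (hlam.succ_lt (max w l).2))).le
    (funSet_ord_mem_vonNeumann s)⟩

theorem pair_mem_ordFun {s : Set.Iio w → Set.Iio l} {x y : Rank lam} :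
    pair x.1 y.1 ∈ (ordFun hlam s).1 ↔ ∃ n, ord n.1 = x ∧ ord (s n).1 = y :=
  pair_mem_funSet

theorem pair_ord_mem_ordFun {s : Set.Iio w → Set.Iio l} {n : Set.Iio w} {y : Rank lam} :
    pair (ord n.1).1 y.1 ∈ (ordFun hlam s).1 ↔ ord (s n).1 = y :=
  pair_mem_funSet_of_injective injective_ord_coe

theorem isSingleValued_ordFun (s : Set.Iio w → Set.Iio l) : IsSingleValued (ordFun hlam s) :=
  isSingleValued_funSet injective_ord_coe _

theorem ordFun_injective :
    Function.Injective (ordFun hlam : (Set.Iio w → Set.Iio l) → Rank lam) := by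
  intro s t hst
  funext n
  have h : pair (ord n.1).1 (ord (s n).1).1 ∈ (ordFun hlam t).1 :=
    hst ▸ pair_ord_mem_ordFun.2 rfl
  exact Subtype.ext (ord_injective (pair_ord_mem_ordFun.1 h)).symm

/-- `t` is a set function from `w` to `l`. -/
def IsFunction (t w l : Rank lam) : Prop :=
  (∀ z ∈ t.1, ∃ n ∈ w.1, ∃ y ∈ l.1, z = pair n y) ∧
    (∀ n : Rank lam, n.1 ∈ w.1 → ∃ y : Rank lam, pair n.1 y.1 ∈ t.1) ∧ IsSingleValued t

theorem Expressible.isFunction (i j k : α) :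
    Expressible fun v : α → Rank lam => IsFunction (v i) (v j) (v k) :=
  (ball _ (bex _ (bex _ (eq_pair _ _ _)))).and
    ((all ((mem _ _).imp (ex (pair_mem _ _ _)))).and (isSingleValued _))

theorem isFunction_iff {t : Rank lam} :
    IsFunction t (ord w) (ord l) ↔ ∃ s : Set.Iio w → Set.Iio l, t = ordFun hlam s := by
  constructor
  · rintro ⟨hsub, htot, huniq⟩
    have hval (n : Set.Iio w) : ∃ b : Set.Iio l, pair (ord n.1).1 (ord b.1).1 ∈ t.1 := by
      obtain ⟨y, hy⟩ := htot (ord n.1) (ord_mem_ord.2 n.2)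
      obtain ⟨_, -, y', hy', hp⟩ := hsub _ hy
      obtain ⟨-, rfl⟩ := pair_inj.1 hp
      obtain ⟨b, hb, rfl⟩ := mem_ord.1 hy'
      exact ⟨⟨b, hb⟩, hy⟩
    choose s hs using hval
    refine ⟨s, Subtype.ext (ZFSet.ext fun z => ⟨fun hz => ?_, fun hz => ?_⟩)⟩
    · obtain ⟨n', hn, y, -, rfl⟩ := hsub z hz
      obtain ⟨hn', hy'⟩ := mem_rank_of_pair_mem hz
      obtain ⟨n, hnw, hnn⟩ := (mem_ord (x := ⟨n', hn'⟩)).1 hn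
      obtain rfl : n' = (ord n).1 := congrArg Subtype.val hnn
      exact (pair_ord_mem_ordFun (n := ⟨n, hnw⟩) (y := ⟨y, hy'⟩)).2
        (Subtype.ext (huniq _ _ _ (hs ⟨n, hnw⟩) hz))
    · obtain ⟨n, rfl⟩ := mem_range.1 hz
      exact hs n
  · rintro ⟨s, rfl⟩
    refine ⟨fun z hz => ?_, fun n hn => ?_, isSingleValued_ordFun s⟩
    · obtain ⟨n, rfl⟩ := mem_range.1 hz
      exact ⟨_, ord_mem_ord.2 n.2, _, ord_mem_ord.2 (s n).2, rfl⟩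
    · obtain ⟨n, hnw, rfl⟩ := mem_ord.1 hn
      exact ⟨_, pair_ord_mem_ordFun (n := ⟨n, hnw⟩).2 rfl⟩

end ordFun

section kunen

variable {e : Rank lam ↪ₑ[setLang] Rank lam} {κ a b l w : Set.Iio lam}

namespace IsCrit

/-- Otherwise `κ ∈ e(κ)` gives `b < κ` with `f(x) = b` by elementarity, so `e(f)(e(x)) = e(b)`. -/
theorem pair_map_ord_notMem (h : IsCrit e κ) {f : Rank lam} (hf : IsSingleValued f)
    (x : Rank lam) : pair (e x).1 (ord κ).1 ∉ (e f).1 := by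
  intro hxκ
  have hE : Expressible fun v : Fin 3 → Rank lam =>
      ∃ y : Rank lam, y.1 ∈ (v 0).1 ∧ pair (v 1).1 y.1 ∈ (v 2).1 :=
    .ex (.and (.mem _ _) (.pair_mem _ _ _))
  have hκ : (ord κ).1 ∈ (e (ord κ)).1 := by rw [map_ord]; exact ord_mem_ord.2 h.1
  obtain ⟨y, hy, hxy⟩ : ∃ y : Rank lam, y.1 ∈ (ord κ).1 ∧ pair x.1 y.1 ∈ f.1 :=
    (hE.map_iff e ![ord κ, x, f]).1 ⟨ord κ, hκ, hxκ⟩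
  obtain ⟨b, -, rfl⟩ := mem_ord.1 hy
  have hb := hf.map e _ _ _ ((pair_map_mem_iff e _ _ _).2 hxy) hxκ
  rw [map_ord] at hb
  exact h.notMem_range_ordMap ⟨b, ord_injective (Subtype.ext hb)⟩

theorem map_ordFun (h : IsCrit e κ) {hlam : Order.IsSuccLimit lam} (hw : w < κ)
    {l' : Set.Iio lam} {s : Set.Iio w → Set.Iio l} {s' : Set.Iio w → Set.Iio l'}
    (hs : ∀ n, (s' n).1 = ordMap e (s n).1) : e (ordFun hlam s) = ordFun hlam s' := by
  have hs_fun : IsFunction (ordFun hlam s) (ord w) (ord l) := isFunction_iff.2 ⟨s, rfl⟩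
  have hfun : IsFunction (e (ordFun hlam s)) (e (ord w)) (e (ord l)) :=
    ((Expressible.isFunction 0 1 2).map_iff e ![ordFun hlam s, ord w, ord l]).2 hs_fun
  rw [h.map_ord_eq hw, map_ord, isFunction_iff (hlam := hlam)] at hfun
  obtain ⟨t, ht⟩ := hfun
  have hval (n : Set.Iio w) : (t n).1 = (s' n).1 := by
    have hn := (pair_map_mem_iff e (ord n.1) (ord (s n).1) (ordFun hlam s)).2
      (pair_ord_mem_ordFun.2 rfl)
    rw [h.map_ord_eq (lt_trans n.2 hw), map_ord, ht, pair_ord_mem_ordFun] at hn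
    exact (ord_injective hn).trans (hs n).symm
  rw [ht]
  refine Subtype.ext ?_
  simp only [ordFun, hval]

/-- Apply `e` to the cofinal function `c`: it remains cofinal, while its values stay below `l`. -/
theorem ordMap_eq_of_cofinal (h : IsCrit e κ) (hlam : Order.IsSuccLimit lam) (hw : w < κ)
    {c : Set.Iio w → Set.Iio l} (hc : ∀ x < l, ∃ n, x < c n) (hcl : ∀ n, ordMap e (c n) < l) :
    ordMap e l = l := by
  refine ((ordMap_strictMono e).le_apply).antisymm' (not_lt.1 fun hl => ?_)
  have hE : Expressible fun v : Fin 2 → Rank lam => ∀ x : Rank lam, x.1 ∈ (v 0).1 →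
      ∃ n y : Rank lam, pair n.1 y.1 ∈ (v 1).1 ∧ x.1 ∈ y.1 :=
    .all (.imp (.mem _ _) (.ex (.ex (.and (.pair_mem _ _ _) (.mem _ _)))))
  have hcof : ∀ x : Rank lam, x.1 ∈ (ord l).1 →
      ∃ n y : Rank lam, pair n.1 y.1 ∈ (ordFun hlam c).1 ∧ x.1 ∈ y.1 := by
    intro x hx
    obtain ⟨a, ha, rfl⟩ := mem_ord.1 hx
    obtain ⟨n, hn⟩ := hc a ha
    exact ⟨ord n.1, ord (c n).1, pair_ord_mem_ordFun.2 rfl, ord_mem_ord.2 hn⟩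
  have hmap : e (ordFun hlam c) = ordFun hlam fun n => ⟨ordMap e (c n), hcl n⟩ :=
    h.map_ordFun hw fun _ => rfl
  have hmem : (ord l).1 ∈ (e (ord l)).1 := by rw [map_ord]; exact ord_mem_ord.2 hl
  obtain ⟨n, y, hny, hly⟩ := (hE.map_iff e ![ord l, ordFun hlam c]).2 hcof (ord l) hmem
  replace hny : pair n.1 y.1 ∈ (e (ordFun hlam c)).1 := hny
  rw [hmap] at hny
  obtain ⟨n, -, rfl⟩ := pair_mem_ordFun.1 hny
  exact (hcl n).not_gt (ord_mem_ord.1 hly)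

end IsCrit

end kunen

section powerset

/-- No set function maps the power set of an element of `k` onto `k`. For ordinals this is a
first-order rendering in `V_lam` of being a strong limit. -/
def NoPowersetSurjection (k : Rank lam) : Prop :=
  ∀ c f : Rank lam, c.1 ∈ k.1 → IsSingleValued f →
    ¬ ∀ x : Rank lam, x.1 ∈ k.1 → ∃ a : Rank lam, a.1 ⊆ c.1 ∧ pair a.1 x.1 ∈ f.1

theorem Expressible.noPowersetSurjection (i : α) :
    Expressible fun v : α → Rank lam => NoPowersetSurjection (v i) :=
  .all (.all ((mem _ _).imp ((isSingleValued _).imp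
    (.not (.all ((mem _ _).imp (.ex ((subset _ _).and (pair_mem _ _ _)))))))))

variable {e : Rank lam ↪ₑ[setLang] Rank lam} {κ a b : Set.Iio lam}

theorem IsCrit.noPowersetSurjection (h : IsCrit e κ) : NoPowersetSurjection (ord κ) := by
  intro c f hc hf hsurj
  obtain ⟨b, hb, rfl⟩ := mem_ord.1 hc
  have hE : Expressible fun v : Fin 3 → Rank lam => ∀ x : Rank lam, x.1 ∈ (v 0).1 →
      ∃ a : Rank lam, a.1 ⊆ (v 1).1 ∧ pair a.1 x.1 ∈ (v 2).1 :=
    .all ((Expressible.mem _ _).imp (.ex ((Expressible.subset _ _).and (.pair_mem _ _ _))))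
  have hκ : (ord κ).1 ∈ (e (ord κ)).1 := by rw [map_ord]; exact ord_mem_ord.2 h.1
  obtain ⟨a, hab, haκ⟩ : ∃ a : Rank lam, a.1 ⊆ (e (ord b)).1 ∧ pair a.1 (ord κ).1 ∈ (e f).1 :=
    (hE.map_iff e ![ord κ, ord b, f]).2 hsurj _ hκ
  rw [h.map_ord_eq hb] at hab
  have hrank : a.1.rank ≤ b.1 := (rank_mono hab).trans_eq (Ordinal.rank_toZFSet _)
  rw [← h.map_eq (hrank.trans_lt hb)] at haκ
  exact h.pair_map_ord_notMem hf a haκ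

theorem NoPowersetSurjection.iterate_ordMap (h : NoPowersetSurjection (ord a)) (n : ℕ) :
    NoPowersetSurjection (ord ((ordMap e)^[n] a)) := by
  induction n with
  | zero => exact h
  | succ n ih =>
    rw [Function.iterate_succ_apply', ← map_ord]
    exact ((Expressible.noPowersetSurjection 0).map_iff e ![ord ((ordMap e)^[n] a)]).2 ih

/-- The set of ordinals `s` as an element of `V_lam`. -/
noncomputable def ordSet (s : Set (Set.Iio b)) : Rank lam :=
  ⟨ZFSet.range fun y : s => (ord y.1.1).1, mem_vonNeumann_of_subset (fun x hx => by
    obtain ⟨y, rfl⟩ := mem_range.1 hx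
    exact ord_mem_ord.2 y.1.2) (ord b).2⟩

theorem ordSet_subset (s : Set (Set.Iio b)) : (ordSet s).1 ⊆ (ord b).1 := fun x hx => by
  obtain ⟨y, rfl⟩ := mem_range.1 hx
  exact ord_mem_ord.2 y.1.2

theorem ord_mem_ordSet {s : Set (Set.Iio b)} {y : Set.Iio b} :
    (ord y.1).1 ∈ (ordSet s).1 ↔ y ∈ s := by
  refine mem_range.trans ⟨?_, fun hy => ⟨⟨y, hy⟩, rfl⟩⟩
  rintro ⟨z, hzy⟩
  obtain rfl : z = y := Subtype.ext (ord_injective (Subtype.ext hzy))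
  exact z.2

theorem ordSet_injective : Function.Injective (ordSet (b := b)) := fun s t hst => by
  ext y
  rw [← ord_mem_ordSet, hst, ord_mem_ordSet]

theorem NoPowersetSurjection.mk_set_lt (h : NoPowersetSurjection (ord a))
    (hlam : Order.IsSuccLimit lam) (hb : b < a) : #(Set (Set.Iio b)) < #(Set.Iio a) := by
  by_contra! hle
  obtain ⟨i, hi⟩ := hle
  have hf : funSet (fun x : Set.Iio a => ordSet (i x)) (fun x => ord x.1) ∈ V_ lam := by
    refine funSet_mem_rank hlam a.2 (fun x => ?_) fun x => ord_mem_vonNeumann.2 x.2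
    exact mem_vonNeumann_of_subset (ordSet_subset _) (ord_mem_vonNeumann.2 hb)
  refine h (ord b) ⟨_, hf⟩ (ord_mem_ord.2 hb)
    (isSingleValued_funSet (ordSet_injective.comp hi) hf) fun x hx => ?_
  obtain ⟨x, hxa, rfl⟩ := mem_ord.1 hx
  exact ⟨ordSet (i ⟨x, hxa⟩), ordSet_subset _, pair_mem_funSet.2 ⟨⟨x, hxa⟩, rfl, rfl⟩⟩

end powerset

section jonsson

/-- `f` is an `ω`-Jónsson function for `l`, with `w` in place of `ω`: on the range of any injection
`g : l → l`, the sequences of length `w` are mapped by `f` onto `l`. -/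
def IsJonsson (f w l : Rank lam) : Prop :=
  IsSingleValued f ∧ ∀ g : Rank lam, IsFunction g l l →
    (∀ x x' y : Rank lam, pair x.1 y.1 ∈ g.1 → pair x'.1 y.1 ∈ g.1 → x.1 = x'.1) →
    ∀ c : Rank lam, c.1 ∈ l.1 → ∃ s : Rank lam, IsFunction s w l ∧
      (∀ n y : Rank lam, pair n.1 y.1 ∈ s.1 → ∃ x : Rank lam, pair x.1 y.1 ∈ g.1) ∧
      pair s.1 c.1 ∈ f.1

theorem Expressible.isJonsson (i j k : α) :
    Expressible fun v : α → Rank lam => IsJonsson (v i) (v j) (v k) :=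
  (isSingleValued _).and (.all ((isFunction _ _ _).imp (.imp
    (.all (.all (.all ((pair_mem _ _ _).imp ((pair_mem _ _ _).imp (eq _ _))))))
    (.all ((mem _ _).imp (.ex ((isFunction _ _ _).and
      (.and (.all (.all ((pair_mem _ _ _).imp (.ex (pair_mem _ _ _))))) (pair_mem _ _ _)))))))))

variable {w l : Set.Iio lam}

theorem exists_isJonsson (hlam : Order.IsSuccLimit lam) [Infinite (Set.Iio l)]
    (hl : #(Set (Set.Iio l)) ≤ #(Set.Iio w → Set.Iio l)) :
    ∃ f, IsJonsson f (ord w) (ord l) := by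
  obtain ⟨F, hF⟩ := exists_jonsson_function hl
  have hf : funSet (ordFun hlam : (Set.Iio w → Set.Iio l) → Rank lam) (fun s => ord (F s).1) ∈
      V_ lam := by
    refine funSet_mem_rank hlam (hlam.succ_lt (hlam.succ_lt (hlam.succ_lt (max w l).2)))
      funSet_ord_mem_vonNeumann fun s => ord_mem_vonNeumann.2 ((F s).2.trans ?_)
    refine lt_of_le_of_lt (b := (max w l).1) (le_max_right w l) ?_
    simp only [Order.lt_succ_iff]
    exact (Order.le_succ _).trans (Order.le_succ _)
  refine ⟨⟨_, hf⟩, isSingleValued_funSet ordFun_injective hf, fun g hg hinj c hc => ?_⟩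
  obtain ⟨G, rfl⟩ := (isFunction_iff (hlam := hlam)).1 hg
  obtain ⟨y, hy, rfl⟩ := mem_ord.1 hc
  have hG : Function.Injective G := fun x x' hxx' => Subtype.ext <| ord_injective <| Subtype.ext <|
    hinj _ _ (ord (G x).1) (pair_ord_mem_ordFun.2 rfl) (pair_ord_mem_ordFun.2 (by rw [hxx']))
  obtain ⟨t, ht⟩ := hF G hG ⟨y, hy⟩
  refine ⟨ordFun hlam (G ∘ t), isFunction_iff.2 ⟨_, rfl⟩, fun n z hnz => ?_,
    pair_mem_funSet.2 ⟨G ∘ t, rfl, by rw [ht]⟩⟩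
  obtain ⟨n, -, rfl⟩ := pair_mem_ordFun.1 hnz
  exact ⟨ord (t n).1, pair_ord_mem_ordFun.2 rfl⟩

end jonsson

section kunen

variable {e : Rank lam ↪ₑ[setLang] Rank lam} {κ w l d : Set.Iio lam}

namespace IsCrit

theorem infinite_Iio (h : IsCrit e κ) (hl : κ < l) : Infinite (Set.Iio l) := by
  have hnat (n : ℕ) : (n : Ordinal.{u}) < l.1 :=
    (Ordinal.natCast_lt_omega0 n).trans (h.omega0_lt.trans hl)
  refine Infinite.of_injective (fun n : ℕ => (⟨⟨n, (hnat n).trans l.2⟩, hnat n⟩ : Set.Iio l)) ?_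
  exact fun m n hmn => Nat.cast_injective (congrArg (fun x : Set.Iio l => x.1.1) hmn)

/-- Kunen's argument: if there were an `ω`-Jónsson function `f` for `l`, then `e(f)` would be one,
and it would take the value `κ` at a sequence `s` of ordinals in the range of `e`. Such a sequence
is itself in the range of `e`, hence so is `κ`. -/
theorem mk_fun_lt_mk_set (h : IsCrit e κ) (hlam : Order.IsSuccLimit lam) (hw : w < κ)
    (hκl : κ < l) (hl : ordMap e l = l) :
    #(Set.Iio w → Set.Iio l) < #(Set (Set.Iio l)) := by
  by_contra! hle
  have := h.infinite_Iio hκl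
  obtain ⟨f, hf⟩ := exists_isJonsson hlam hle
  have hef : IsJonsson (e f) (e (ord w)) (e (ord l)) :=
    ((Expressible.isJonsson 0 1 2).map_iff e ![f, ord w, ord l]).2 hf
  rw [h.map_ord_eq hw, map_ord, hl] at hef
  have hmaps (x : Set.Iio l) : ordMap e x.1 < l := (ordMap_strictMono e x.2).trans_eq hl
  let g : Set.Iio l → Set.Iio l := fun x => ⟨ordMap e x.1, hmaps x⟩
  have hg : ∀ x x' y : Rank lam, pair x.1 y.1 ∈ (ordFun hlam g).1 →
      pair x'.1 y.1 ∈ (ordFun hlam g).1 → x.1 = x'.1 := by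
    intro x x' y hx hx'
    obtain ⟨n, rfl, rfl⟩ := pair_mem_ordFun.1 hx
    obtain ⟨n', rfl, hn'⟩ := pair_mem_ordFun.1 hx'
    rw [(ordMap_strictMono e).injective (ord_injective hn')]
  obtain ⟨s, hs, hsg, hsκ⟩ := hef.2 _ (isFunction_iff.2 ⟨g, rfl⟩) hg (ord κ) (ord_mem_ord.2 hκl)
  obtain ⟨q, rfl⟩ := (isFunction_iff (hlam := hlam)).1 hs
  have hq (n : Set.Iio w) : ∃ x : Set.Iio l, ordMap e x.1 = (q n).1 := by
    obtain ⟨x, hx⟩ := hsg (ord n.1) (ord (q n).1) (pair_ord_mem_ordFun.2 rfl)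
    obtain ⟨x, -, hx⟩ := pair_mem_ordFun.1 hx
    exact ⟨x, ord_injective hx⟩
  choose t ht using hq
  rw [← h.map_ordFun hw fun n => (ht n).symm] at hsκ
  exact h.pair_map_ord_notMem hf.1 _ hsκ

theorem strictMono_iterate (h : IsCrit e κ) : StrictMono fun n => (ordMap e)^[n] κ :=
  (ordMap_strictMono e).strictMono_iterate_of_lt_map h.1

theorem exists_surjective_nat (h : IsCrit e κ) :
    ∃ w < κ, ∃ N : Set.Iio w → ℕ, Function.Surjective N := by
  refine ⟨⟨Ordinal.omega0, h.omega0_lt.trans κ.2⟩, h.omega0_lt, ?_⟩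
  choose N hN using fun n : Set.Iio (⟨Ordinal.omega0, h.omega0_lt.trans κ.2⟩ : Set.Iio lam) =>
    Ordinal.lt_omega0.1 n.2
  refine ⟨N, fun m => ?_⟩
  have hm := Ordinal.natCast_lt_omega0.{u} m
  exact ⟨⟨⟨m, hm.trans (h.omega0_lt.trans κ.2)⟩, hm⟩, Nat.cast_injective (hN _).symm⟩

theorem ordMap_eq_of_isLUB (h : IsCrit e κ) (hlam : Order.IsSuccLimit lam)
    (hl : IsLUB (Set.range fun n => (ordMap e)^[n] κ) l) : ordMap e l = l := by
  obtain ⟨w, hw, N, hN⟩ := h.exists_surjective_nat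
  have hlt (n : ℕ) : (ordMap e)^[n] κ < l :=
    (h.strictMono_iterate n.lt_succ_self).trans_le (hl.1 ⟨n + 1, rfl⟩)
  refine h.ordMap_eq_of_cofinal hlam hw (c := fun i => ⟨(ordMap e)^[N i] κ, hlt _⟩)
    (fun x hx => ?_) fun i => ?_
  · obtain ⟨_, ⟨n, rfl⟩, hn⟩ := (lt_isLUB_iff hl).1 hx
    obtain ⟨i, rfl⟩ := hN n
    exact ⟨i, hn⟩
  · exact (Function.iterate_succ_apply' _ _ _).symm.trans_lt (hlt (N i + 1))

theorem not_isLUB_iterate (h : IsCrit e κ) (hlam : Order.IsSuccLimit lam) (l : Set.Iio lam) :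
    ¬ IsLUB (Set.range fun n => (ordMap e)^[n] κ) l := by
  intro hl
  obtain ⟨w, hw, N, hN⟩ := h.exists_surjective_nat
  have hκl : κ < l := h.1.trans_le (hl.1 ⟨1, rfl⟩)
  refine (h.mk_fun_lt_mk_set hlam hw hκl (h.ordMap_eq_of_isLUB hlam hl)).not_ge ?_
  refine mk_set_le_mk_fun (fun i : Set.Iio w => {x : Set.Iio l | x.1 < (ordMap e)^[N i] κ})
    (fun x => ?_) fun i => ?_
  · obtain ⟨_, ⟨n, rfl⟩, hn⟩ := (lt_isLUB_iff hl).1 x.2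
    obtain ⟨i, rfl⟩ := hN n
    exact ⟨i, hn⟩
  · have hstrong := (h.noPowersetSurjection.iterate_ordMap (N i + 1)).mk_set_lt hlam
      (h.strictMono_iterate (N i).lt_succ_self)
    have hcard : #{x : Set.Iio l | x.1 < (ordMap e)^[N i] κ} ≤ #(Set.Iio ((ordMap e)^[N i] κ)) :=
      mk_le_of_injective (f := fun x => ⟨x.1.1, x.2⟩) fun x y hxy =>
        by simpa only [Subtype.ext_iff] using hxy
    rw [mk_set] at hstrong ⊢
    exact (power_le_power_left two_ne_zero hcard).trans <| hstrong.le.trans <|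
      mk_le_mk_of_subset (Set.Iio_subset_Iio (hl.1 ⟨N i + 1, rfl⟩))

theorem exists_le_ordMap (h : IsCrit e κ) (hlam : Order.IsSuccLimit lam) (hd : κ < d) :
    ∃ a < d, d ≤ ordMap e a := by
  by_contra! hmaps
  have hiter (n : ℕ) : (ordMap e)^[n] κ < d := by
    induction n with
    | zero => exact hd
    | succ n ih =>
      rw [Function.iterate_succ_apply']
      exact hmaps _ ih
  have hbdd : (upperBounds (Set.range fun n => (ordMap e)^[n] κ)).Nonempty :=
    ⟨d, by rintro _ ⟨n, rfl⟩; exact (hiter n).le⟩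
  obtain ⟨l, hl, hmin⟩ := wellFounded_lt.has_min _ hbdd
  exact h.not_isLUB_iterate hlam l ⟨hl, fun x hx => not_lt.1 (hmin x hx)⟩

end IsCrit

end kunen

section definability

variable {A B : Set ZFSet.{u}} {b : Rank lam}

theorem mem_defIn_of_expressible {n : ℕ} {R : (Fin n → Rank lam) → Rank lam → Prop}
    (hR : Expressible fun v : Fin n ⊕ Unit → Rank lam => R (fun i => v (.inl i)) (v (.inr ())))
    {w : Fin n → Rank lam} (hw : ∀ i, (w i).1 ∈ A) (hb : ∀ y, R w y ↔ y = b) :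
    b.1 ∈ DefIn lam A := by
  obtain ⟨φ, hφ⟩ := hR
  let σ : Fin n ⊕ Unit → {x : Rank lam | x.1 ∈ A} ⊕ Fin 1 :=
    Sum.map (fun i => ⟨w i, hw i⟩) fun _ => 0
  refine ⟨b.2, Set.definable_iff_exists_formula_sum.2 ⟨φ.relabel σ, Set.ext fun v => ?_⟩⟩
  have hφv : φ.Realize (Sum.elim Subtype.val v ∘ σ) ↔ R w (v 0) := hφ _
  exact (hb (v 0)).symm.trans (hφv.symm.trans Language.Formula.realize_relabel.symm)

theorem exists_expressible_of_mem_defIn (h : b.1 ∈ DefIn lam A) :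
    ∃ (n : ℕ) (R : (Fin n → Rank lam) → Rank lam → Prop) (w : Fin n → Rank lam),
      (Expressible fun v : Fin n ⊕ Unit → Rank lam => R (fun i => v (.inl i)) (v (.inr ()))) ∧
      (∀ i, (w i).1 ∈ A) ∧ ∀ y, R w y ↔ y = b := by
  obtain ⟨hb, h⟩ := h
  obtain ⟨A₀, hA₀, h⟩ := Set.definable_iff_finitely_definable.1 h
  obtain ⟨φ, hφ⟩ := Set.definable_iff_exists_formula_sum.1 h
  let ψ : setLang.Formula (Fin A₀.card ⊕ Unit) := φ.relabel (Sum.map A₀.equivFin fun _ => ())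
  refine ⟨A₀.card, fun v y => ψ.Realize (Sum.elim v fun _ => y), fun i => (A₀.equivFin.symm i).1,
    ⟨ψ, fun v => ?_⟩, fun i => hA₀ (A₀.equivFin.symm i).2, fun y => ?_⟩
  · rw [← Sum.elim_comp_inl_inr v]
    rfl
  · refine (Language.Formula.realize_relabel.trans (Eq.to_iff ?_)).trans
      (Set.ext_iff.1 hφ fun _ => y).symm
    refine congrArg φ.Realize (funext ?_)
    rintro (i | i)
    · simp
    · rfl

theorem rng_subset_defIn {k : ZFSet.{u}} (hk : k ∈ Emb lam) : rng k ⊆ DefIn lam (rng k ∪ B) := by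
  obtain ⟨e, -, rfl⟩ := hk
  intro y hy
  obtain ⟨x, rfl⟩ := mem_rng_graph.1 hy
  exact ⟨(e x).2, Set.Definable.singleton_of_mem _ (Or.inl hy)⟩

theorem mem_defIn_of_not_isSuccLimit {δ : Set.Iio lam} (hδ : ¬ Order.IsSuccLimit δ.1) :
    (ord δ).1 ∈ DefIn lam (A ∪ {x | x ∈ V_ δ.1}) := by
  rcases not_isSuccLimit_iff.1 hδ with h | ⟨y, hy, h⟩
  · refine mem_defIn_of_expressible (n := 0) (R := fun _ x => x.1 = ∅) (w := ![]) (.eq_empty _)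
      (fun i => i.elim0) fun x => ?_
    rw [← h]
    exact (Subtype.ext_iff (a1 := x) (a2 := ord δ)).symm
  · have hyδ : y ∈ V_ δ.1 := Ordinal.toZFSet_subset_vonNeumann δ.1 hy
    refine mem_defIn_of_expressible (n := 1) (R := fun w x => x.1 = insert (w 0).1 (w 0).1)
      (w := ![⟨y, mem_rank_of_mem (y := ord δ) hy⟩]) (.eq_insert _ _ _) (fun i => ?_) fun x => ?_
    · fin_cases i
      exact .inr hyδ
    · change x.1 = insert y y ↔ x = ord δ
      rw [← h]
      exact (Subtype.ext_iff (a1 := x) (a2 := ord δ)).symm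

/-- `A` contains `∅` and is closed under pairs, hence contains the codes of its finite tuples. -/
structure IsPairClosed (A : Set ZFSet.{u}) : Prop where
  empty_mem : ∅ ∈ A
  pair_mem {x y : ZFSet.{u}} : x ∈ A → y ∈ A → pair x y ∈ A

theorem isPairClosed_vonNeumann {d : Ordinal.{u}} (hd : Order.IsSuccLimit d) :
    IsPairClosed {x | x ∈ V_ d} where
  empty_mem := mem_vonNeumann.2 (by rw [rank_empty]; exact hd.bot_lt)
  pair_mem := pair_mem_vonNeumann hd

theorem isPairClosed_rng_graph (hlam : Order.IsSuccLimit lam) (e : Rank lam ↪ₑ[setLang] Rank lam) :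
    IsPairClosed (rng (graph e)) where
  empty_mem := by
    have h0 : (∅ : ZFSet.{u}) ∈ V_ lam := (isPairClosed_vonNeumann hlam).empty_mem
    exact mem_rng_graph.2 ⟨⟨∅, h0⟩, ((Expressible.eq_empty 0).map_iff e ![⟨∅, h0⟩]).2 rfl⟩
  pair_mem {x y} hx hy := by
    obtain ⟨x, rfl⟩ := mem_rng_graph.1 hx
    obtain ⟨y, rfl⟩ := mem_rng_graph.1 hy
    let p : Rank lam := ⟨pair x.1 y.1, pair_mem_vonNeumann hlam x.2 y.2⟩
    exact mem_rng_graph.2 ⟨p, ((Expressible.eq_pair 0 1 2).map_iff e ![p, x, y]).2 rfl⟩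

/-- A set coding the tuple `q`, by iterated pairing. -/
def tupleCode : ∀ {n : ℕ}, (Fin n → ZFSet.{u}) → ZFSet.{u}
  | 0, _ => ∅
  | _ + 1, q => pair (q 0) (tupleCode fun i => q i.succ)

theorem tupleCode_injective {n : ℕ} : Function.Injective (tupleCode (n := n)) := by
  induction n with
  | zero => exact fun _ _ _ => Subsingleton.elim _ _
  | succ n ih =>
    intro q q' h
    obtain ⟨h0, hsucc⟩ := pair_inj.1 h
    exact funext (Fin.cases h0 (congrFun (ih hsucc)))

theorem IsPairClosed.tupleCode_mem (hA : IsPairClosed A) {n : ℕ} {q : Fin n → ZFSet.{u}}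
    (hq : ∀ i, q i ∈ A) : tupleCode q ∈ A := by
  induction n with
  | zero => exact hA.empty_mem
  | succ n ih => exact hA.pair_mem (hq 0) (ih fun i => hq i.succ)

theorem Expressible.eq_tupleCode (i : α) {n : ℕ} (σ : Fin n → α) :
    Expressible fun v : α → Rank lam => (v i).1 = tupleCode fun k => (v (σ k)).1 := by
  induction n generalizing α with
  | zero => exact eq_empty i
  | succ n ih =>
    refine congr (P := fun v => ∃ c : Rank lam, c.1 = (tupleCode fun k => (v (σ k.succ)).1) ∧
      (v i).1 = pair (v (σ 0)).1 c.1) (.ex (.and (ih _ _) (.eq_pair _ _ _))) fun v => ⟨?_, ?_⟩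
    · intro h
      rw [tupleCode] at h
      have hpair : {(v (σ 0)).1, tupleCode fun k => (v (σ k.succ)).1} ∈ V_ lam :=
        mem_rank_of_mem (y := v i) (by rw [h]; simp [pair])
      exact ⟨⟨_, mem_rank_of_mem (y := ⟨_, hpair⟩) (mem_pair.2 (.inr rfl))⟩, rfl, h⟩
    · rintro ⟨c, hc, h⟩
      rw [h, hc, tupleCode]

theorem Expressible.exists_eq_tupleCode (i : α) {n : ℕ}
    {R : (α → Rank lam) → (Fin n → Rank lam) → Prop}
    (hR : Expressible fun v : α ⊕ Fin n → Rank lam =>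
      R (fun i => v (.inl i)) (fun k => v (.inr k))) :
    Expressible fun v => ∃ q, (v i).1 = tupleCode (fun k => (q k).1) ∧ R v q :=
  exists_tuple (.and (eq_tupleCode _ _) hR)

theorem exists_eq_tupleCode_and_iff {n : ℕ} {P : (Fin n → Rank lam) → Prop} {q : Fin n → Rank lam} :
    (∃ q', tupleCode (fun k => (q k).1) = tupleCode (fun k => (q' k).1) ∧ P q') ↔ P q := by
  refine ⟨fun ⟨q', hq', h⟩ => ?_, fun h => ⟨q, rfl, h⟩⟩
  rwa [show q = q' from funext fun k => Subtype.ext (congrFun (tupleCode_injective hq') k)]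

theorem exists_expressible_of_mem_defIn_union {z : Rank lam} (hzA : z.1 ∈ A) (hzB : z.1 ∈ B)
    (hb : b.1 ∈ DefIn lam (A ∪ B)) :
    ∃ (n : ℕ) (R : (Fin n → Rank lam) → (Fin n → Rank lam) → Rank lam → Prop)
      (q r : Fin n → Rank lam), (Expressible fun v : (Unit ⊕ Fin n) ⊕ Fin n → Rank lam =>
        R (fun i => v (.inl (.inr i))) (fun i => v (.inr i)) (v (.inl (.inl ())))) ∧
      (∀ i, (q i).1 ∈ A) ∧ (∀ i, (r i).1 ∈ B) ∧ ∀ y, R q r y ↔ y = b := by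
  classical
  obtain ⟨n, R, w, hR, hw, hRb⟩ := exists_expressible_of_mem_defIn hb
  have hsplit (i) : ∃ q r : Rank lam, q.1 ∈ A ∧ r.1 ∈ B ∧
      (if (w i).1 ∈ A then q else r) = w i := by
    by_cases h : (w i).1 ∈ A
    · exact ⟨w i, z, h, hzB, if_pos h⟩
    · exact ⟨z, w i, hzA, (hw i).resolve_left h, if_neg h⟩
  choose q r hq hr hqr using hsplit
  refine ⟨n, fun q r => R fun i => if (w i).1 ∈ A then q i else r i, q, r, ?_, hq, hr, ?_⟩
  · refine (hR.comp (Sum.elim (fun i => if (w i).1 ∈ A then Sum.inl (Sum.inr i) else Sum.inr i)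
      fun _ => Sum.inl (Sum.inl ()))).congr fun v => ?_
    simp only [Sum.elim_inl, Sum.elim_inr, apply_ite v]
  · simpa only [hqr] using hRb

theorem IsPairClosed.exists_expressible₃_of_mem_defIn (hA : IsPairClosed A)
    (hlam : Order.IsSuccLimit lam) (hB : IsPairClosed B) (hb : b.1 ∈ DefIn lam (A ∪ B)) :
    ∃ R : Rank lam → Rank lam → Rank lam → Prop,
      (Expressible fun v : Fin 3 → Rank lam => R (v 0) (v 1) (v 2)) ∧
      ∃ x p : Rank lam, x.1 ∈ A ∧ p.1 ∈ B ∧ ∀ y, R x p y ↔ y = b := by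
  have hV : IsPairClosed {x | x ∈ V_ lam} := isPairClosed_vonNeumann hlam
  obtain ⟨n, R, q, r, hR, hq, hr, hRb⟩ :=
    exists_expressible_of_mem_defIn_union (z := ⟨∅, hV.empty_mem⟩) hA.empty_mem hB.empty_mem hb
  refine ⟨fun x p y => ∃ q, x.1 = tupleCode (fun i : Fin n => (q i).1) ∧
    ∃ r, p.1 = tupleCode (fun i : Fin n => (r i).1) ∧ R q r y, ?_,
    ⟨_, hV.tupleCode_mem fun i => (q i).2⟩, ⟨_, hV.tupleCode_mem fun i => (r i).2⟩,
    hA.tupleCode_mem hq, hB.tupleCode_mem hr, fun y => ?_⟩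
  · exact .exists_eq_tupleCode 0 (.exists_eq_tupleCode (Sum.inl 1)
      (hR.comp (Sum.map (Sum.map (fun _ => 2) id) id)))
  · simp only [exists_eq_tupleCode_and_iff, hRb]

end definability

section product

variable {e f g : Rank lam ↪ₑ[setLang] Rank lam} {A : Set ZFSet.{u}}

theorem exists_mem_rng_of_app_eq (hg : app lam (graph e) (graph f) = graph g) (x : Rank lam) :
    ∃ c : Rank lam, c.1 ∈ rng (graph e) ∧ ∀ y : Rank lam, pair x.1 y.1 ∈ c.1 ↔ y = g x := by
  have hx : pair x.1 (g x).1 ∈ app lam (graph e) (graph f) := hg ▸ pair_mem_graph_iff.2 rfl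
  obtain ⟨a, ha⟩ := mem_app_graph.1 hx
  refine ⟨e (graphPart f a), mem_rng_graph.2 ⟨_, rfl⟩, fun y => ⟨fun hy => ?_, ?_⟩⟩
  · have : pair x.1 y.1 ∈ app lam (graph e) (graph f) := mem_app_graph.2 ⟨a, hy⟩
    rw [hg] at this
    exact (pair_mem_graph_iff.1 this).symm
  · rintro rfl
    exact ha

theorem mem_defIn_of_app_eq (hg : app lam (graph e) (graph f) = graph g) (hA : rng (graph e) ⊆ A)
    {Q : Rank lam → Rank lam → Rank lam → Prop}
    (hQ : Expressible fun v : Fin 3 → Rank lam => Q (v 0) (v 1) (v 2)) {x p b : Rank lam}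
    (hx : x.1 ∈ A) (hp : p.1 ∈ A) (hb : ∀ y, Q (g x) p y ↔ y = b) : b.1 ∈ DefIn lam A := by
  obtain ⟨c, hc, h⟩ := exists_mem_rng_of_app_eq hg x
  refine mem_defIn_of_expressible (R := fun w y => ∃ z : Rank lam, pair (w 1).1 z.1 ∈ (w 0).1 ∧
    Q z (w 2) y) (w := ![c, x, p]) ?_ (fun i => ?_) fun y => ?_
  · exact .ex ((Expressible.pair_mem _ _ _).and (hQ.comp
      ![Sum.inr (), Sum.inl (Sum.inl 2), Sum.inl (Sum.inr ())]))
  · fin_cases i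
    exacts [hA hc, hx, hp]
  · change (∃ z : Rank lam, pair x.1 z.1 ∈ c.1 ∧ Q z p y) ↔ y = b
    simp only [h, exists_eq_left, hb]

theorem exists_forall_pair_mem_map_iff (g : Rank lam ↪ₑ[setLang] Rank lam)
    {R : Rank lam → Rank lam → Rank lam → Prop}
    (hR : Expressible fun v : Fin 3 → Rank lam => R (v 0) (v 1) (v 2)) (x : Rank lam)
    {a : Set.Iio lam} {d : Ordinal.{u}} (hd : Order.IsSuccLimit d) (hdl : d ≤ lam) (had : a < d) :
    ∃ s : Rank lam, s.1 ∈ V_ d ∧ ∀ p b : Rank lam, p.1 ∈ V_ (ordMap g a).1 →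
      b.1 ∈ V_ (ordMap g a).1 → (∀ z, R (g x) p z ↔ z = b) →
      ∀ y : Rank lam, pair p.1 y.1 ∈ (g s).1 ↔ y = b := by
  let S : ZFSet.{u} := (V_ (Order.succ (Order.succ a.1))).sep fun t =>
    ∃ p z : Rank lam, t = pair p.1 z.1 ∧ ∀ z', R x p z' ↔ z' = z
  have hSd : S ∈ V_ d := mem_vonNeumann_of_subset (fun _ ht => (mem_sep.1 ht).1)
    (vonNeumann_mem_of_lt (hd.succ_lt (hd.succ_lt had)))
  let s : Rank lam := ⟨S, vonNeumann_subset_of_le hdl hSd⟩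
  have hE : Expressible fun v : Fin 3 → Rank lam => ∀ p b : Rank lam, p.1 ∈ (v 1).1 →
      b.1 ∈ (v 1).1 → (∀ z, R (v 2) p z ↔ z = b) → ∀ y : Rank lam, pair p.1 y.1 ∈ (v 0).1 ↔ y = b :=
    .all (.all (.imp (.mem _ _) (.imp (.mem _ _) (.imp
      (.all (.iff
        (hR.comp ![Sum.inl (Sum.inl (Sum.inl 2)), Sum.inl (Sum.inl (Sum.inr ())), Sum.inr ()])
        (.eq_rank _ _)))
      (.all (.iff (.pair_mem _ _ _) (.eq_rank _ _)))))))
  have hs : ∀ p b : Rank lam, p.1 ∈ (level a).1 → b.1 ∈ (level a).1 →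
      (∀ z, R x p z ↔ z = b) → ∀ y : Rank lam, pair p.1 y.1 ∈ s.1 ↔ y = b := by
    intro p b hp hb hpb y
    change pair p.1 y.1 ∈ S ↔ y = b
    rw [mem_sep]
    constructor
    · rintro ⟨-, p', z, hpz, hz⟩
      obtain ⟨hpp', hyz⟩ := pair_inj.1 hpz
      obtain rfl := Subtype.ext hpp'
      obtain rfl := Subtype.ext hyz
      exact (hpb y).1 ((hz y).2 rfl)
    · rintro rfl
      exact ⟨pair_mem_vonNeumann_succ_succ hp hb, p, y, rfl, hpb⟩
  refine ⟨s, hSd, ?_⟩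
  have := (hE.map_iff g ![s, level a, x]).2 hs
  change ∀ p b : Rank lam, p.1 ∈ (g (level a)).1 → b.1 ∈ (g (level a)).1 → _ at this
  rwa [map_level] at this

theorem mem_defIn_of_mem_defIn_app (hlam : Order.IsSuccLimit lam)
    (hg : app lam (graph e) (graph f) = graph g) {d : Ordinal.{u}} (hd : Order.IsSuccLimit d)
    (hdl : d ≤ lam) {a : Set.Iio lam} (had : a < d) (hda : d ≤ ordMap g a) {b : Rank lam}
    (hba : b.1 ∈ V_ (ordMap g a).1) (hb : b.1 ∈ DefIn lam (rng (graph g) ∪ {x | x ∈ V_ d})) :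
    b.1 ∈ DefIn lam (rng (graph e) ∪ {x | x ∈ V_ d}) := by
  obtain ⟨R, hR, gx, p, hgx, hp, hRb⟩ :=
    (isPairClosed_rng_graph hlam g).exists_expressible₃_of_mem_defIn hlam
      (isPairClosed_vonNeumann hd) hb
  obtain ⟨x, hx⟩ := mem_rng_graph.1 hgx
  obtain rfl : g x = gx := Subtype.ext hx
  obtain ⟨s, hs, hsb⟩ := exists_forall_pair_mem_map_iff g hR x hd hdl had
  exact mem_defIn_of_app_eq hg Set.subset_union_left
    (Q := fun z p y => pair p.1 y.1 ∈ z.1) (.pair_mem 1 2 0) (.inr hs) (.inr hp)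
    (hsb p b (vonNeumann_subset_of_le hda hp) hba hRb)

theorem defIn_app_inter_interval (hlam : Order.IsSuccLimit lam) {j k : ZFSet.{u}}
    (hj : j ∈ Emb lam) (hk : k ∈ Emb lam) {δ μ : Ordinal.{u}} (hcrit : crit (app lam j k) < δ)
    (hdef : DefIn lam (rng j ∪ {x | x ∈ V_ δ}) ∩ interval δ μ = ∅) :
    DefIn lam (rng (app lam j k) ∪ {x | x ∈ V_ δ}) ∩ interval δ μ = ∅ := by
  have hundef {o : Set.Iio lam} (ho : (ord o).1 ∈ DefIn lam (rng j ∪ {x | x ∈ V_ δ}))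
      (hδo : δ ≤ o) : μ ≤ o := by
    by_contra! hoμ
    exact Set.eq_empty_iff_forall_notMem.1 hdef _ ⟨ho, _, ⟨hδo, hoμ⟩, rfl⟩
  obtain ⟨g, hg_ne, hg⟩ := app_mem_emb hlam hj hk
  obtain ⟨e, -, rfl⟩ := hj
  obtain ⟨f, -, rfl⟩ := hk
  obtain ⟨κ, hκ⟩ := exists_isCrit hg_ne
  rw [hg, hκ.crit_graph] at hcrit
  refine Set.eq_empty_iff_forall_notMem.2 ?_
  rintro _ ⟨ho, o, ⟨hδo, hoμ⟩, rfl⟩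
  have holam : o < lam := by simpa [mem_vonNeumann] using ho.1
  lift o to Set.Iio lam using holam
  lift δ to Set.Iio lam using hδo.trans_lt o.2
  have hlim : Order.IsSuccLimit δ.1 := by
    by_contra hδ
    exact (hundef (mem_defIn_of_not_isSuccLimit hδ) le_rfl).not_gt (hδo.trans_lt hoμ)
  obtain ⟨a, haδ, hδa⟩ := hκ.exists_le_ordMap hlam hcrit
  have hga : (ord (ordMap g a)).1 ∈ DefIn lam (rng (graph e) ∪ {x | x ∈ V_ δ.1}) := by
    have ha : (ord a).1 ∈ V_ δ.1 := ord_mem_vonNeumann.2 haδ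
    rw [← map_ord]
    exact mem_defIn_of_app_eq hg Set.subset_union_left (Q := fun z _ y => y = z) (.eq_rank 2 0)
      (.inr ha) (.inr ha) fun _ => Iff.rfl
  have hoa : (ord o).1 ∈ V_ (ordMap g a).1 :=
    ord_mem_vonNeumann.2 (hoμ.trans_le (hundef hga hδa))
  rw [hg] at ho
  exact (hundef (mem_defIn_of_mem_defIn_app hlam hg hlim δ.2.le haδ hδa hoa ho) hδo).not_gt hoμ

end product

end RankToRank

theorem lemma21_general (lam : Ordinal.{u}) (hlam : Order.IsSuccLimit lam)
    (j : ZFSet.{u}) (hj : j ∈ RankToRank.Emb lam) (δ μ : Ordinal.{u})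
    (hdef : RankToRank.DefIn lam (RankToRank.rng j ∪ {x | x ∈ ZFSet.vonNeumann δ}) ∩
      RankToRank.interval δ μ = ∅)
    (n : ℕ) (js : ℕ → ZFSet.{u}) (hjs : ∀ i < n, js i ∈ RankToRank.Emb lam)
    (hcrits : ∀ i < n, RankToRank.crit (RankToRank.leftProd lam j js (i + 1)) < δ) :
    RankToRank.DefIn lam
        (RankToRank.rng (RankToRank.leftProd lam j js n) ∪ {x | x ∈ ZFSet.vonNeumann δ}) ∩
      RankToRank.interval δ μ = ∅ := by
  induction n with
  | zero => exact hdef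
  | succ n ih =>
    have hjs' : ∀ i < n, js i ∈ RankToRank.Emb lam := fun i hi => hjs i (hi.trans n.lt_succ_self)
    exact RankToRank.defIn_app_inter_interval hlam (RankToRank.leftProd_mem_emb hlam hj hjs')
      (hjs n n.lt_succ_self) (hcrits n n.lt_succ_self)
      (ih hjs' fun i hi => hcrits i (hi.trans n.lt_succ_self))

theorem lemma21 (lam : Ordinal.{u}) (hlam : Order.IsSuccLimit lam)
    (j : ZFSet.{u}) (hj : j ∈ RankToRank.Emb lam)
    (δ μ : Ordinal.{u}) (hδ : δ.IsInitial) (hμ : μ.IsInitial)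
    (hcrit : RankToRank.crit j < δ) (hδμ : δ < μ) (hμlam : μ < lam)
    (hdef : RankToRank.DefIn lam (RankToRank.rng j ∪ {x | x ∈ ZFSet.vonNeumann δ}) ∩
      RankToRank.interval δ μ = ∅)
    (n : ℕ) (js : ℕ → ZFSet.{u}) (hjs : ∀ i < n, js i ∈ RankToRank.Emb lam)
    (hcrits : ∀ i ≤ n, RankToRank.crit (RankToRank.leftProd lam j js i) < δ) :
    RankToRank.rng (RankToRank.leftProd lam j js n) ∩ RankToRank.interval δ μ = ∅ := by
  exact Set.subset_eq_empty (Set.inter_subset_inter_left _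
    (RankToRank.rng_subset_defIn (RankToRank.leftProd_mem_emb hlam hj hjs)))
    (lemma21_general lam hlam j hj δ μ hdef n js hjs fun i hi => hcrits (i + 1) hi)
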